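/- Let $Q$ be a smooth ($C^\infty$) finite-dimensional manifold without boundary, Hausdorff and second countable, with projections $\tau_Q : TQ\to Q$ and $\pi_Q : T^*Q\to Q$. For a manifold $M$ let $\theta_M$ be the Liouville $1$-form on $T^*M$, $\theta_M(\alpha)(X)=\alpha(T\pi_M X)$, and $\omega_M=-d\theta_M$. Let $U\subseteq TQ$ be an open neighbourhood of the zero section and let $R_d=(R^1,R^2):U\to Q\times Q$ be a discretization map on $Q$, i.e. a smooth map such that for every $x\in Q$: (1) $R_d(0_x)=(x,x)$; (2) $T_{0_x}R^2_x-T_{0_x}R^1_x=\mathrm{Id}_{T_xQ}$, where $R^a_x$ is the restriction of $R^a$ to $U\cap T_xQ$ and $T_{0_x}T_xQ\simeq T_xQ$. Consider: Tulczyjew's map $\alpha_Q:TT^*Q\to T^*TQ$, in induced coordinates $(q,p,\dot q,\dot p)\mapsto(q,\dot q,\dot p,p)$; the map $\widehat{R_d}$ with $\widehat{R_d}(\alpha_\xi)=\alpha_\xi\circ(T_\xi R_d)^{-1}\in T^*_{R_d(\xi)}(Q\times Q)$ for $\alpha_\xi\in T^*_\xi TQ$ (defined where $T_\xi R_d$ is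 invertible); the bijection $\Phi:T^*Q\times T^*Q\to T^*(Q\times Q)$, $(q_0,p_0;q_1,p_1)\mapsto(q_0,q_1,-p_0,p_1)$; and the cotangent lift $R_d^{T^*}=\Phi^{-1}\circ\widehat{R_d}\circ\alpha_Q$. On $TT^*Q$ take the $2$-form $d_T\omega_Q$, where $d_T=i_Td+d\,i_T$ and $(i_T\eta)_v(X_1,\dots,X_k)=\eta(v,T\tau X_1,\dots,T\tau X_k)$ for a $(k+1)$-form $\eta$ on a manifold $M$, $v\in TM$, $X_i\in T_vTM$, and $\tau:TM\to M$ the projection (in coordinates, $d_T\omega_Q=dq\wedge d\dot p+d\dot q\wedge dp$). On $T^*Q\times T^*Q$ take $\Omega_{12}=\mathrm{pr}_2^*\omega_Q-\mathrm{pr}_1^*\omega_Q$. Then $d_T\omega_Q$ and $\Omega_{12}$ are symplectic forms. There is an open neighbourhood $V\subseteq U$ of the zero section such that $R_d$ restricts to a diffeomorphism from $V$ onto an open subset of $Q\times Q$. And for every open $V\subseteq U$ such that $R_d$ restricts to a diffeomorphism from $V$ onto an open set $R_d(V)$, the cotangent lift $R_d^{T^*}$ restricts to a symplectomorphism from the open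 set $(T\pi_Q)^{-1}(V)\subseteq TT^*Q$ with the form $d_T\omega_Q$ onto the open set $(\pi_Q\times\pi_Q)^{-1}(R_d(V))\subseteq T^*Q\times T^*Q$ with the form $\Omega_{12}$: it is a smooth diffeomorphism between these sets and $(R_d^{T^*})^*\Omega_{12}=d_T\omega_Q$ on $(T\pi_Q)^{-1}(V)$. In particular, if $U=TQ$ and $R_d:TQ\to Q\times Q$ is a diffeomorphism, then $R_d^{T^*}$ is a symplectomorphism from $(TT^*Q,d_T\omega_Q)$ onto $(T^*Q\times T^*Q,\Omega_{12})$. -/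

import Mathlib

open Set Bundle
open scoped Manifold ContDiff Topology

noncomputable section

/-! ### Differential forms on a manifold -/

section Forms

variable {E : Type*} [NormedAddCommGroup E] [NormedSpace ℝ E]
  {H : Type*} [TopologicalSpace H] (I : ModelWithCorners ℝ E H)
  (M : Type*) [TopologicalSpace M] [ChartedSpace H M]
  {E' : Type*} [NormedAddCommGroup E'] [NormedSpace ℝ E']
  {H' : Type*} [TopologicalSpace H'] (J : ModelWithCorners ℝ E' H')
  {N : Type*} [TopologicalSpace N] [ChartedSpace H' N]

/-- Real-valued differential `k`-forms on `M` (no regularity imposed). -/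
abbrev DiffForm (k : ℕ) : Type _ := (x : M) → TangentSpace I x [⋀^Fin k]→L[ℝ] ℝ

variable {M}

/-- The pull-back `f^* η` of a form along a map. -/
def DiffForm.pullback {k : ℕ} (f : M → N) (η : DiffForm J N k) : DiffForm I M k :=
  fun x => (η (f x)).compContinuousLinearMap (mfderiv I J f x)

/-- The expression of a form in the preferred chart around `x₀`: the pull-back of `η` under the
inverse chart, as a form on the model vector space. -/
def DiffForm.inChart {k : ℕ} (η : DiffForm I M k) (x₀ : M) : E → E [⋀^Fin k]→L[ℝ] ℝ :=
  fun y => (η ((extChartAt I x₀).symm y)).compContinuousLinearMap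
    (mfderivWithin 𝓘(ℝ, E) I (extChartAt I x₀).symm (range I) y)

/-- The exterior derivative of a form on a manifold, computed at `x` in the chart around `x`. -/
def DiffForm.d {k : ℕ} (η : DiffForm I M k) : DiffForm I M (k + 1) :=
  fun x => ContinuousAlternatingMap.compContinuousLinearMap
    (extDerivWithin (DiffForm.inChart I η x) (range I) (extChartAt I x x))
    (mfderiv I 𝓘(ℝ, E) (extChartAt I x) x)

/-- A form is smooth if its expressions in charts have smooth coefficients. -/
def DiffForm.IsSmooth {k : ℕ} (η : DiffForm I M k) : Prop :=
  ∀ x₀ : M, ContDiffOn ℝ ∞ (DiffForm.inChart I η x₀) (extChartAt I x₀).target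

/-- A symplectic form: a smooth, closed, nondegenerate 2-form. -/
structure DiffForm.IsSymplectic (η : DiffForm I M 2) : Prop where
  smooth : DiffForm.IsSmooth I η
  closed : DiffForm.d I η = 0
  nondegenerate : ∀ (x : M) (v : TangentSpace I x),
    (∀ w : TangentSpace I x, η x ![v, w] = 0) → v = 0

/-- `i_T η`, the `k`-form on `TM` attached to a `(k+1)`-form `η` on `M`:
`(i_T η)_v (X₁, …, X_k) = η (v, Tτ X₁, …, Tτ X_k)`, with `τ : TM → M` the projection. -/
def DiffForm.iT [IsManifold I ∞ M] {k : ℕ} (η : DiffForm I M (k + 1)) :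
    DiffForm I.tangent (TangentBundle I M) k :=
  fun v => ContinuousAlternatingMap.compContinuousLinearMap
    (ContinuousAlternatingMap.curryLeft (E := E) (η v.proj) v.snd)
    (mfderiv I.tangent I (TotalSpace.proj : TangentBundle I M → M) v)

/-- Tulczyjew's derivation `d_T = i_T d + d i_T`, from forms on `M` to forms on `TM`. -/
def DiffForm.dT [IsManifold I ∞ M] {k : ℕ} (η : DiffForm I M (k + 1)) :
    DiffForm I.tangent (TangentBundle I M) (k + 1) :=
  DiffForm.iT I (DiffForm.d I η) + DiffForm.d I.tangent (DiffForm.iT I η)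

/-- `f` restricts to a smooth diffeomorphism from the open set `A` onto the open set `B`. -/
def IsDiffeoOn (f : M → N) (A : Set M) (B : Set N) : Prop :=
  IsOpen A ∧ IsOpen B ∧ BijOn f A B ∧ ContMDiffOn I J ∞ f A ∧
    ∃ g : N → M, LeftInvOn g f A ∧ ContMDiffOn J I ∞ g B

/-- `f` restricts to a diffeomorphism from the open set `A` onto the open set `B` and
`f^* η₂ = η₁` on `A`. -/
def IsSymplectoOn (η₁ : DiffForm I M 2) (η₂ : DiffForm J N 2) (f : M → N)
    (A : Set M) (B : Set N) : Prop :=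
  IsDiffeoOn I J f A B ∧ ∀ x ∈ A, DiffForm.pullback I J f η₂ x = η₁ x

end Forms

/-! ### The cotangent bundle and its canonical symplectic form -/

section Cotangent

variable {E : Type*} [NormedAddCommGroup E] [NormedSpace ℝ E]
  {H : Type*} [TopologicalSpace H] (I : ModelWithCorners ℝ E H)
  (M : Type*) [TopologicalSpace M] [ChartedSpace H M]
  {E' : Type*} [NormedAddCommGroup E'] [NormedSpace ℝ E']
  {H' : Type*} [TopologicalSpace H'] (J : ModelWithCorners ℝ E' H')
  {N : Type*} [TopologicalSpace N] [ChartedSpace H' N]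

/-- The cotangent bundle `T^*M`, with the topology and smooth structure that Mathlib puts on the
bundle of continuous linear maps from the tangent bundle to the trivial line bundle. -/
abbrev CotangentBundle : Type _ :=
  TotalSpace (E →L[ℝ] ℝ) (fun x : M => TangentSpace I x →L[ℝ] Bundle.Trivial M ℝ x)

/-- The model of the manifold `T^*M`. -/
abbrev ModelWithCorners.cotangent : ModelWithCorners ℝ (E × (E →L[ℝ] ℝ)) (ModelProd H (E →L[ℝ] ℝ)) :=
  I.prod 𝓘(ℝ, E →L[ℝ] ℝ)

variable {M}

/-- The canonical projection `π_M : T^*M → M`. -/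
abbrev cotangentProj : CotangentBundle I M → M := TotalSpace.proj

variable (M) in
/-- The Liouville 1-form: `θ_M(α)(X) = α (Tπ_M X)`. -/
def liouvilleForm [IsManifold I ∞ M] : DiffForm I.cotangent (CotangentBundle I M) 1 :=
  fun α => ContinuousAlternatingMap.ofSubsingleton ℝ (TangentSpace I.cotangent α) ℝ (0 : Fin 1)
    (ContinuousLinearMap.comp (α.snd : TangentSpace I α.proj →L[ℝ] ℝ)
      (mfderiv I.cotangent I (cotangentProj I (M := M)) α))

variable (M) in
/-- The canonical 2-form `ω_M = -dθ_M` on `T^*M`. -/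
def canonicalForm [IsManifold I ∞ M] : DiffForm I.cotangent (CotangentBundle I M) 2 :=
  -DiffForm.d I.cotangent (liouvilleForm I M)

variable (M) in
/-- The 2-form `Ω₁₂ = pr₂^* ω_M - pr₁^* ω_M` on `T^*M × T^*M`. -/
def omega12 [IsManifold I ∞ M] :
    DiffForm (I.cotangent.prod I.cotangent) (CotangentBundle I M × CotangentBundle I M) 2 :=
  DiffForm.pullback (I.cotangent.prod I.cotangent) I.cotangent Prod.snd (canonicalForm I M)
    - DiffForm.pullback (I.cotangent.prod I.cotangent) I.cotangent Prod.fst (canonicalForm I M)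

/-- `\hat F : T^*M → T^*N`, `\hat F (α_x) = α_x ∘ (T_x F)⁻¹ ∈ T^*_{F x} N`, the cotangent lift of
`F⁻¹`. It is meaningful at the points where `T_x F` is invertible; elsewhere
`ContinuousLinearMap.inverse` is `0` by convention. -/
def cotangentHat (F : M → N) (α : CotangentBundle I M) : CotangentBundle J N :=
  ⟨F α.proj, ContinuousLinearMap.comp (α.snd : TangentSpace I α.proj →L[ℝ] ℝ)
    (ContinuousLinearMap.inverse (mfderiv I J F α.proj))⟩

/-- `Φ : T^*M × T^*M → T^*(M × M)`, `Φ(q₀, p₀; q₁, p₁) = (q₀, q₁, -p₀, p₁)`. -/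
def cotangentPhi :
    CotangentBundle I M × CotangentBundle I M ≃ CotangentBundle (I.prod I) (M × M) where
  toFun a := ⟨(a.1.proj, a.2.proj),
    -(ContinuousLinearMap.comp (a.1.snd : E →L[ℝ] ℝ) (ContinuousLinearMap.fst ℝ E E))
      + ContinuousLinearMap.comp (a.2.snd : E →L[ℝ] ℝ) (ContinuousLinearMap.snd ℝ E E)⟩
  invFun γ :=
    (⟨γ.proj.1, -ContinuousLinearMap.comp (γ.snd : E × E →L[ℝ] ℝ)
        (ContinuousLinearMap.inl ℝ E E)⟩,
      ⟨γ.proj.2, ContinuousLinearMap.comp (γ.snd : E × E →L[ℝ] ℝ)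
        (ContinuousLinearMap.inr ℝ E E)⟩)
  left_inv := by
    rintro ⟨⟨x, a⟩, ⟨y, b⟩⟩
    have h (a b : E →L[ℝ] ℝ) : -((-a.comp (ContinuousLinearMap.fst ℝ E E) +
        b.comp (ContinuousLinearMap.snd ℝ E E)).comp (ContinuousLinearMap.inl ℝ E E)) = a := by
      ext; simp
    have h' (a b : E →L[ℝ] ℝ) : (-a.comp (ContinuousLinearMap.fst ℝ E E) +
        b.comp (ContinuousLinearMap.snd ℝ E E)).comp (ContinuousLinearMap.inr ℝ E E) = b := by
      ext; simp
    exact Prod.ext (congrArg (TotalSpace.mk x) (h a b)) (congrArg (TotalSpace.mk y) (h' a b))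
  right_inv := by
    rintro ⟨⟨x, y⟩, c⟩
    have h (c : E × E →L[ℝ] ℝ) : -(-c.comp (ContinuousLinearMap.inl ℝ E E)).comp
        (ContinuousLinearMap.fst ℝ E E) + (c.comp (ContinuousLinearMap.inr ℝ E E)).comp
        (ContinuousLinearMap.snd ℝ E E) = c := by
      ext u
      · simp; exact map_zero c
      · simp; exact map_zero c
    exact congrArg (TotalSpace.mk (x, y)) (h c)

/-- Tulczyjew's map `α_M : T(T^*M) → T^*(TM)`, `(q, p, q̇, ṗ) ↦ (q, q̇, ṗ, p)`.

A vector `v` tangent to `T^*M` at `(q, p)` is stored by Mathlib as the pair `(q̇, ṗ)` of its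
coordinates in the chart of `T^*M` induced by the preferred chart of `M` around `q`; likewise a
vector tangent to `TM` at `(q, q̇)` is stored as the pair `(δq, δv)` of its coordinates in the chart
of `TM` induced by that same chart of `M`. The covector with coordinates `(ṗ, p)` is
`(δq, δv) ↦ ṗ(δq) + p(δv)`. -/
def tulczyjewAlpha [IsManifold I ∞ M] (v : TangentBundle I.cotangent (CotangentBundle I M)) :
    CotangentBundle I.tangent (TangentBundle I M) :=
  ⟨⟨v.proj.proj, (v.snd : E × (E →L[ℝ] ℝ)).1⟩,
    ContinuousLinearMap.comp (v.snd : E × (E →L[ℝ] ℝ)).2 (ContinuousLinearMap.fst ℝ E E)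
      + ContinuousLinearMap.comp (v.proj.snd : E →L[ℝ] ℝ) (ContinuousLinearMap.snd ℝ E E)⟩

end Cotangent

/-! ### Discretization maps and their cotangent lifts -/

section Discretization

variable {E : Type*} [NormedAddCommGroup E] [NormedSpace ℝ E]
  {H : Type*} [TopologicalSpace H] (I : ModelWithCorners ℝ E H)
  {Q : Type*} [TopologicalSpace Q] [ChartedSpace H Q] [IsManifold I ∞ Q]

/-- The derivative `T_{0_x} F_x : T_{0_x} T_x Q ≃ T_x Q → T_{F(0_x)} Q` of the restriction `F_x` of `F` to
the fibre `T_x Q`; Mathlib represents all these tangent spaces by the model space `E`. -/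
def fiberDeriv (F : TangentBundle I Q → Q) (x : Q) : E →L[ℝ] E :=
  mfderiv 𝓘(ℝ, E) I (fun v : E => F ⟨x, v⟩) (0 : E)

/-- `R` (whose values outside `U` are irrelevant) is a discretization map `U ⊆ TQ → Q × Q`.
In `rigid`, both derivatives take values in `T_x Q` by `map_zero`. -/
structure IsDiscretizationMap (U : Set (TangentBundle I Q)) (R : TangentBundle I Q → Q × Q) :
    Prop where
  isOpen : IsOpen U
  zero_mem : ∀ x : Q, (⟨x, 0⟩ : TangentBundle I Q) ∈ U
  smooth : ContMDiffOn I.tangent (I.prod I) ∞ R U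
  map_zero : ∀ x : Q, R ⟨x, 0⟩ = (x, x)
  rigid : ∀ x : Q, fiberDeriv I (fun ξ => (R ξ).2) x - fiberDeriv I (fun ξ => (R ξ).1) x
    = ContinuousLinearMap.id ℝ E

/-- The cotangent lift `R^{T^*} = Φ⁻¹ ∘ \hat R ∘ α_Q : T(T^*Q) → T^*Q × T^*Q`. -/
def cotangentLift (R : TangentBundle I Q → Q × Q) :
    TangentBundle I.cotangent (CotangentBundle I Q) → CotangentBundle I Q × CotangentBundle I Q :=
  (cotangentPhi I).symm ∘ cotangentHat I.tangent (I.prod I) R ∘ tulczyjewAlpha I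

end Discretization

end

/-! The Liouville 1-forms carry the proof. Put θ₁₂ = pr₂^*θ_Q - pr₁^*θ_Q. Each factor of the
cotangent lift respects them: Φ⁻¹ pulls θ₁₂ back to θ_{Q×Q}, the sign in Φ absorbing the sign in θ₁₂
(`pullback_cotangentPhi_symm_theta12`); `\hat R` pulls θ_{Q×Q} back to θ_{TQ}, as every cotangent
lift does (`pullback_cotangentHat_liouvilleForm`); and Tulczyjew's map pulls θ_{TQ} back to d_T θ_Q
(`pullback_tulczyjewAlpha_liouvilleForm`). Hence the lift pulls θ₁₂ back to d_T θ_Q. Applying -d,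
which is natural (`DiffForm.d_pullback`), gives the identity between Ω₁₂ and d_T ω_Q.

In charts induced from Q these 1-forms have linear coefficients and the 2-forms constant ones, the
same in every chart (`DiffForm.HasChartExpr`). Smoothness, closedness, nondegeneracy and d_T ω =
-d(d_T θ) thereby become facts about bilinear forms on a vector space.

Over V the lift is bijective, because it covers the injective map R and is bijective on fibres. Its
derivative is injective, since the pulled-back form is nondegenerate; source and target have equal
dimension, so the inverse function theorem makes it a diffeomorphism.

For the existence of V: R sends the zero section to the diagonal and the fibre derivatives of its
components differ by the identity, so T R is invertible at each 0_x. Local injectivity along the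
zero section then becomes injectivity on a neighbourhood of all of it by a metric argument
(`exists_isOpen_injOn_of_section`). -/

noncomputable section

/-! ### Derivatives of maps of manifolds, read in the model spaces -/

section Derivative

variable {E : Type*} [NormedAddCommGroup E] [NormedSpace ℝ E]
  {H : Type*} [TopologicalSpace H] (I : ModelWithCorners ℝ E H)
  {E' : Type*} [NormedAddCommGroup E'] [NormedSpace ℝ E']
  {H' : Type*} [TopologicalSpace H'] (J : ModelWithCorners ℝ E' H')
  {N : Type*} [TopologicalSpace N] [ChartedSpace H' N]
  {E'' : Type*} [NormedAddCommGroup E''] [NormedSpace ℝ E'']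
  {H'' : Type*} [TopologicalSpace H''] (K : ModelWithCorners ℝ E'' H'')
  {P : Type*} [TopologicalSpace P] [ChartedSpace H'' P]
  {M : Type*} [TopologicalSpace M] [ChartedSpace H M]

/-- The derivative `mfderiv I J f x`, as a map between the model vector spaces. -/
def tderiv (f : M → N) (x : M) : E →L[ℝ] E' := mfderiv I J f x

variable {I J K}

theorem tderiv_comp {g : N → P} {f : M → N} (x : M) (hg : MDifferentiableAt J K g (f x))
    (hf : MDifferentiableAt I J f x) :
    tderiv I K (g ∘ f) x = tderiv J K g (f x) ∘L tderiv I J f x :=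
  mfderiv_comp x hg hf

theorem tderiv_comp_of_eq {g : N → P} {f : M → N} {x : M} {y : N}
    (hg : MDifferentiableAt J K g y)
    (hf : MDifferentiableAt I J f x) (hy : f x = y) :
    tderiv I K (g ∘ f) x = tderiv J K g y ∘L tderiv I J f x := by
  subst hy; exact tderiv_comp x hg hf

theorem tderiv_congr {f g : M → N} {x : M} (h : f =ᶠ[𝓝 x] g) :
    tderiv I J f x = tderiv I J g x := h.mfderiv_eq

theorem tderiv_id (x : M) : tderiv I I (id : M → M) x = ContinuousLinearMap.id ℝ E := mfderiv_id

theorem tderiv_eq_fderiv (f : E → E') (x : E) : tderiv 𝓘(ℝ, E) 𝓘(ℝ, E') f x = fderiv ℝ f x :=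
  mfderiv_eq_fderiv

theorem tderiv_eq_fderiv_writtenInExtChartAt [I.Boundaryless] {f : M → N} {x : M}
    (hf : MDifferentiableAt I J f x) :
    tderiv I J f x = fderiv ℝ (writtenInExtChartAt I J x f) (extChartAt I x x) := by
  unfold tderiv
  rw [hf.mfderiv, I.range_eq_univ, fderivWithin_univ]

theorem tderiv_fst (x : M × N) :
    tderiv (I.prod J) I Prod.fst x = ContinuousLinearMap.fst ℝ E E' := mfderiv_fst

theorem tderiv_snd (x : M × N) :
    tderiv (I.prod J) J Prod.snd x = ContinuousLinearMap.snd ℝ E E' := mfderiv_snd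

theorem tderiv_prodMk {f : M → N} {g : M → P} {x : M} (hf : MDifferentiableAt I J f x)
    (hg : MDifferentiableAt I K g x) :
    tderiv I (J.prod K) (fun x => (f x, g x)) x = (tderiv I J f x).prod (tderiv I K g x) :=
  (hf.hasMFDerivAt.prodMk hg.hasMFDerivAt).mfderiv

theorem fst_comp_tderiv {f : M → E' × E''} {x : M} (hf : MDifferentiableAt I 𝓘(ℝ, E' × E'') f x) :
    ContinuousLinearMap.fst ℝ E' E'' ∘L tderiv I 𝓘(ℝ, E' × E'') f x =
      tderiv I 𝓘(ℝ, E') (fun y => (f y).1) x := by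
  have h : MDifferentiableAt 𝓘(ℝ, E' × E'') 𝓘(ℝ, E') Prod.fst (f x) :=
    differentiableAt_fst.mdifferentiableAt
  rw [← fderiv_fst (𝕜 := ℝ) (p := f x), ← tderiv_eq_fderiv, ← tderiv_comp x h hf]
  rfl

theorem snd_comp_tderiv {f : M → E' × E''} {x : M} (hf : MDifferentiableAt I 𝓘(ℝ, E' × E'') f x) :
    ContinuousLinearMap.snd ℝ E' E'' ∘L tderiv I 𝓘(ℝ, E' × E'') f x =
      tderiv I 𝓘(ℝ, E'') (fun y => (f y).2) x := by
  have h : MDifferentiableAt 𝓘(ℝ, E' × E'') 𝓘(ℝ, E'') Prod.snd (f x) :=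
    differentiableAt_snd.mdifferentiableAt
  rw [← fderiv_snd (𝕜 := ℝ) (p := f x), ← tderiv_eq_fderiv, ← tderiv_comp x h hf]
  rfl

section Charts

variable [IsManifold I 1 M]

theorem tderiv_extChartAt_self (x : M) :
    tderiv I 𝓘(ℝ, E) (extChartAt I x) x = ContinuousLinearMap.id ℝ E :=
  mfderiv_extChartAt_self

variable [I.Boundaryless]

theorem mdifferentiableAt_extChartAt_symm {x : M} {y : E} (hy : y ∈ (extChartAt I x).target) :
    MDifferentiableAt 𝓘(ℝ, E) I (extChartAt I x).symm y := by
  have := mdifferentiableWithinAt_extChartAt_symm (I := I) hy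
  rwa [I.range_eq_univ, mdifferentiableWithinAt_univ] at this

theorem tderiv_extChartAt_symm_comp {x y : M} (hy : y ∈ (extChartAt I x).source) :
    tderiv 𝓘(ℝ, E) I (extChartAt I x).symm (extChartAt I x y) ∘L
      tderiv I 𝓘(ℝ, E) (extChartAt I x) y = ContinuousLinearMap.id ℝ E := by
  have := mfderivWithin_extChartAt_symm_comp_mfderiv_extChartAt' (I := I) hy
  rw [I.range_eq_univ, mfderivWithin_univ] at this
  exact this

theorem tderiv_extChartAt_comp {x y : M} (hy : y ∈ (extChartAt I x).source) :
    tderiv I 𝓘(ℝ, E) (extChartAt I x) y ∘L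
      tderiv 𝓘(ℝ, E) I (extChartAt I x).symm (extChartAt I x y) = ContinuousLinearMap.id ℝ E := by
  have := mfderiv_extChartAt_comp_mfderivWithin_extChartAt_symm' (I := I) hy
  rw [I.range_eq_univ, mfderivWithin_univ] at this
  exact this

theorem isInvertible_tderiv_extChartAt {x y : M} (hy : y ∈ (extChartAt I x).source) :
    (tderiv I 𝓘(ℝ, E) (extChartAt I x) y).IsInvertible :=
  .of_inverse (tderiv_extChartAt_comp hy) (tderiv_extChartAt_symm_comp hy)

/-- Away from the centre of the chart the chart derivatives are no longer the identity and must be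
kept; statements about neighbourhoods (naturality of `d`, smoothness of cotangent lifts) need this
version. -/
theorem fderiv_writtenInExtChartAt [IsManifold J 1 N] {f : M → N} {x y : M}
    (hy : y ∈ (extChartAt I x).source) (hfy : f y ∈ (extChartAt J (f x)).source)
    (hf : MDifferentiableAt I J f y) :
    fderiv ℝ (writtenInExtChartAt I J x f) (extChartAt I x y) =
      tderiv J 𝓘(ℝ, E') (extChartAt J (f x)) (f y) ∘L
        tderiv I J f y ∘L tderiv 𝓘(ℝ, E) I (extChartAt I x).symm (extChartAt I x y) := by
  have h1 := mdifferentiableAt_extChartAt_symm ((extChartAt I x).map_source hy)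
  have h2 := mdifferentiableAt_extChartAt (I := J) (by simpa only [extChartAt_source] using hfy)
  have hl := (extChartAt I x).left_inv hy
  rw [← tderiv_eq_fderiv, ← tderiv_comp_of_eq hf h1 hl]
  exact tderiv_comp_of_eq h2 ((hl.symm ▸ hf : MDifferentiableAt I J f _).comp _ h1)
    (by rw [Function.comp_apply, hl])

end Charts

end Derivative

/-! ### Naturality of the exterior derivative and coordinate expressions of forms -/

section Forms

variable {E : Type*} [NormedAddCommGroup E] [NormedSpace ℝ E]
  {H : Type*} [TopologicalSpace H] {I : ModelWithCorners ℝ E H}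
  {M : Type*} [TopologicalSpace M] [ChartedSpace H M]
  {E' : Type*} [NormedAddCommGroup E'] [NormedSpace ℝ E']
  {H' : Type*} [TopologicalSpace H'] {J : ModelWithCorners ℝ E' H'}
  {N : Type*} [TopologicalSpace N] [ChartedSpace H' N]
  {k : ℕ}

namespace DiffForm

/-- The value of a form at a point, as an alternating map on the model vector space. -/
def coef (η : DiffForm I M k) (x : M) : E [⋀^Fin k]→L[ℝ] ℝ := η x

/-- A form on the model vector space. -/
def ofModel (η : E → E [⋀^Fin k]→L[ℝ] ℝ) : DiffForm 𝓘(ℝ, E) E k := η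

theorem coef_ext {η η' : DiffForm I M k} {x : M} (h : coef η x = coef η' x) : η x = η' x := h

@[simp] theorem coef_ofModel (η : E → E [⋀^Fin k]→L[ℝ] ℝ) : coef (ofModel η) = η := rfl

theorem coef_pullback (f : M → N) (η : DiffForm J N k) (x : M) :
    coef (pullback I J f η) x = (coef η (f x)).compContinuousLinearMap (tderiv I J f x) := rfl

theorem coef_sub (η η' : DiffForm I M k) (x : M) : coef (η - η') x = coef η x - coef η' x := rfl

theorem pullback_comp {E'' : Type*} [NormedAddCommGroup E''] [NormedSpace ℝ E'']
    {H'' : Type*} [TopologicalSpace H''] {K : ModelWithCorners ℝ E'' H''}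
    {P : Type*} [TopologicalSpace P] [ChartedSpace H'' P] {g : N → P} {f : M → N} {x : M}
    (hg : MDifferentiableAt J K g (f x)) (hf : MDifferentiableAt I J f x) (η : DiffForm K P k) :
    pullback I K (g ∘ f) η x = pullback I J f (pullback J K g η) x := by
  apply coef_ext
  rw [coef_pullback, coef_pullback, coef_pullback, tderiv_comp x hg hf]
  rfl

theorem inChart_apply [I.Boundaryless] (η : DiffForm I M k) (x₀ : M) (y : E) :
    inChart I η x₀ y = (coef η ((extChartAt I x₀).symm y)).compContinuousLinearMap
      (tderiv 𝓘(ℝ, E) I (extChartAt I x₀).symm y) := by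
  unfold inChart
  rw [I.range_eq_univ, mfderivWithin_univ]
  rfl

theorem coef_d [I.Boundaryless] [IsManifold I 1 M] (η : DiffForm I M k) (x : M) :
    coef (d I η) x = extDeriv (inChart I η x) (extChartAt I x x) := by
  have : coef (d I η) x = (extDerivWithin (inChart I η x) (range I)
    (extChartAt I x x)).compContinuousLinearMap (tderiv I 𝓘(ℝ, E) (extChartAt I x) x) := rfl
  rw [this, tderiv_extChartAt_self, I.range_eq_univ, extDerivWithin_univ]
  rfl

/-- The inverse chart around `f x` followed by that chart is inserted after `f`, and the chain rule
does the rest. It holds only near the centre, where `f` is differentiable and stays in the chart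
around `f x`. -/
theorem inChart_pullback_eventuallyEq [I.Boundaryless] [J.Boundaryless]
    [IsManifold I 1 M] [IsManifold J 1 N] {f : M → N} {x : M} (hf : ContMDiffAt I J ∞ f x)
    (η : DiffForm J N k) :
    inChart I (pullback I J f η) x =ᶠ[𝓝 (extChartAt I x x)]
      fun y => (inChart J η (f x) (writtenInExtChartAt I J x f y)).compContinuousLinearMap
        (fderiv ℝ (writtenInExtChartAt I J x f) y) := by
  have hs : ContinuousAt (extChartAt I x).symm (extChartAt I x x) :=
    continuousAt_extChartAt_symm x
  have hx : (extChartAt I x).symm (extChartAt I x x) = x := extChartAt_to_inv x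
  have e1 : ∀ᶠ y in 𝓝 (extChartAt I x x), y ∈ (extChartAt I x).target :=
    extChartAt_target_mem_nhds x
  have e2 : ∀ᶠ y in 𝓝 (extChartAt I x x),
      f ((extChartAt I x).symm y) ∈ (extChartAt J (f x)).source := by
    have : ContinuousAt (f ∘ (extChartAt I x).symm) (extChartAt I x x) :=
      ContinuousAt.comp (by rw [hx]; exact hf.continuousAt) hs
    refine this.preimage_mem_nhds ?_
    rw [Function.comp_apply, hx]; exact extChartAt_source_mem_nhds (f x)
  have e3 : ∀ᶠ y in 𝓝 (extChartAt I x x), MDifferentiableAt I J f ((extChartAt I x).symm y) := by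
    refine hs.preimage_mem_nhds (t := {z | MDifferentiableAt I J f z}) ?_
    rw [hx]
    have h1 : ContMDiffAt I J 1 f x := hf.of_le (by norm_cast)
    filter_upwards [(contMDiffAt_iff_contMDiffAt_nhds (by simp)).1 h1] with z hz
      using hz.mdifferentiableAt (by simp)
  filter_upwards [e1, e2, e3] with y h1 h2 h3
  have h4 := fderiv_writtenInExtChartAt ((extChartAt I x).map_target h1) h2 h3
  rw [(extChartAt I x).right_inv h1] at h4
  have h5 := tderiv_extChartAt_symm_comp h2
  have h6 : writtenInExtChartAt I J x f y = extChartAt J (f x) (f ((extChartAt I x).symm y)) := rfl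
  ext v
  simp only [inChart_apply, coef_pullback, h4, h6,
    ContinuousAlternatingMap.compContinuousLinearMap_apply]
  rw [(extChartAt J (f x)).left_inv h2]
  congr 1
  funext i
  exact (DFunLike.congr_fun h5 _).symm

/-- The exterior derivative is natural: `d (f^* η) = f^* (d η)`. -/
theorem d_pullback [I.Boundaryless] [J.Boundaryless]
    [IsManifold I 1 M] [IsManifold J 1 N] {f : M → N} {x : M} (hf : ContMDiffAt I J ∞ f x)
    {η : DiffForm J N k}
    (hη : DifferentiableAt ℝ (inChart J η (f x)) (extChartAt J (f x) (f x))) :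
    d I (pullback I J f η) x = pullback I J f (d J η) x := by
  have hw : writtenInExtChartAt I J x f (extChartAt I x x) = extChartAt J (f x) (f x) := by
    simp [writtenInExtChartAt]
  have hc : ContDiffAt ℝ ∞ (writtenInExtChartAt I J x f) (extChartAt I x x) := by
    have := (contMDiffAt_iff.1 hf).2
    rw [I.range_eq_univ] at this
    exact this.contDiffAt Filter.univ_mem
  -- Naturality on vector spaces. At the centres of the charts no correction factor appears, as the
  -- chart derivatives there are the identity.
  have hd := extDeriv_pullback (x := extChartAt I x x)
    (f := writtenInExtChartAt I J x f) (by rw [hw]; exact hη) hc (by simpa using (mod_cast le_top : ((2 : ℕ∞) : WithTop ℕ∞) ≤ ∞))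
  apply coef_ext
  rw [coef_pullback, coef_d, coef_d, (inChart_pullback_eventuallyEq hf η).extDeriv_eq, hd, hw,
    tderiv_eq_fderiv_writtenInExtChartAt (hf.mdifferentiableAt (by simp))]

theorem inChart_congr [I.Boundaryless] {η η' : DiffForm I M k} {x : M}
    (h : ∀ᶠ y in 𝓝 x, η y = η' y) :
    inChart I η x =ᶠ[𝓝 (extChartAt I x x)] inChart I η' x := by
  have hs : ContinuousAt (extChartAt I x).symm (extChartAt I x x) :=
    continuousAt_extChartAt_symm x
  rw [ContinuousAt, extChartAt_to_inv] at hs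
  filter_upwards [hs.eventually h] with y hy
  simp only [inChart, hy]

/-- The exterior derivative is local. -/
theorem d_congr [I.Boundaryless] {η η' : DiffForm I M k} {x : M} (h : ∀ᶠ y in 𝓝 x, η y = η' y) :
    d I η x = d I η' x := by
  unfold d
  rw [(inChart_congr h).extDerivWithin_eq_nhds]

theorem inChart_ofModel (η : E → E [⋀^Fin k]→L[ℝ] ℝ) (x₀ : E) :
    inChart 𝓘(ℝ, E) (ofModel η) x₀ = η := by
  funext y
  have : tderiv 𝓘(ℝ, E) 𝓘(ℝ, E) (extChartAt 𝓘(ℝ, E) x₀).symm y = ContinuousLinearMap.id ℝ E :=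
    tderiv_id y
  rw [inChart_apply, this]
  rfl

theorem d_ofModel (η : E → E [⋀^Fin k]→L[ℝ] ℝ) :
    d 𝓘(ℝ, E) (ofModel η) = ofModel (extDeriv η) := by
  funext y
  apply coef_ext
  rw [coef_d, inChart_ofModel]
  rfl

theorem d_pullback_ofModel [I.Boundaryless] [IsManifold I 1 M] {f : M → E'} {x : M}
    (hf : ContMDiffAt I 𝓘(ℝ, E') ∞ f x) {η : E' → E' [⋀^Fin k]→L[ℝ] ℝ}
    (hη : Differentiable ℝ η) :
    d I (pullback I 𝓘(ℝ, E') f (ofModel η)) x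
      = pullback I 𝓘(ℝ, E') f (ofModel (extDeriv η)) x := by
  rw [d_pullback hf (by rw [inChart_ofModel]; exact hη _), d_ofModel]

/-- `η` has the coordinate expression `η₀` in the preferred chart around `x₀`. -/
def HasChartExpr (η : DiffForm I M k) (x₀ : M) (η₀ : E → E [⋀^Fin k]→L[ℝ] ℝ) : Prop :=
  ∀ x ∈ (extChartAt I x₀).source,
    η x = pullback I 𝓘(ℝ, E) (extChartAt I x₀) (ofModel η₀) x

theorem HasChartExpr.inChart_eqOn [I.Boundaryless] [IsManifold I 1 M] {η : DiffForm I M k} {x₀ : M}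
    {η₀ : E → E [⋀^Fin k]→L[ℝ] ℝ} (h : HasChartExpr η x₀ η₀) :
    EqOn (inChart I η x₀) η₀ (extChartAt I x₀).target := by
  intro y hy
  have hs := (extChartAt I x₀).map_target hy
  have h1 : coef η ((extChartAt I x₀).symm y) = _ := h _ hs
  have h2 := tderiv_extChartAt_comp hs
  rw [(extChartAt I x₀).right_inv hy] at h2
  rw [inChart_apply, h1]
  ext v
  change coef (ofModel η₀) (extChartAt I x₀ ((extChartAt I x₀).symm y)) (fun i =>
    (tderiv I 𝓘(ℝ, E) (extChartAt I x₀) ((extChartAt I x₀).symm y) ∘L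
      tderiv 𝓘(ℝ, E) I (extChartAt I x₀).symm y) (v i)) = η₀ y v
  rw [h2, (extChartAt I x₀).right_inv hy]
  rfl

/-- By definition `d` at `x` is computed in the chart around `x`, not in the one around `x₀`;
naturality under the chart around `x₀` bridges the two. -/
theorem HasChartExpr.d [I.Boundaryless] [IsManifold I ∞ M] {η : DiffForm I M k} {x₀ : M}
    {η₀ : E → E [⋀^Fin k]→L[ℝ] ℝ} (h : HasChartExpr η x₀ η₀) (hη : Differentiable ℝ η₀) :
    HasChartExpr (DiffForm.d I η) x₀ (extDeriv η₀) := by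
  intro x hx
  have hx' : x ∈ (chartAt H x₀).source := by simpa using hx
  rw [← d_pullback_ofModel (contMDiffAt_extChartAt' hx') hη]
  apply d_congr
  filter_upwards [extChartAt_source_mem_nhds' hx] with y hy using h y hy

theorem HasChartExpr.add {η η' : DiffForm I M k} {x₀ : M}
    {η₀ η₀' : E → E [⋀^Fin k]→L[ℝ] ℝ} (h : HasChartExpr η x₀ η₀) (h' : HasChartExpr η' x₀ η₀') :
    HasChartExpr (η + η') x₀ (η₀ + η₀') := by
  intro x hx
  rw [Pi.add_apply, h x hx, h' x hx]
  rfl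

theorem HasChartExpr.sub {η η' : DiffForm I M k} {x₀ : M}
    {η₀ η₀' : E → E [⋀^Fin k]→L[ℝ] ℝ} (h : HasChartExpr η x₀ η₀) (h' : HasChartExpr η' x₀ η₀') :
    HasChartExpr (η - η') x₀ (η₀ - η₀') := by
  intro x hx
  rw [Pi.sub_apply, h x hx, h' x hx]
  rfl

theorem HasChartExpr.neg {η : DiffForm I M k} {x₀ : M}
    {η₀ : E → E [⋀^Fin k]→L[ℝ] ℝ} (h : HasChartExpr η x₀ η₀) :
    HasChartExpr (-η) x₀ (-η₀) := by
  intro x hx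
  rw [Pi.neg_apply, h x hx]
  rfl

/-- A form with the same nondegenerate constant coefficients in all charts is symplectic. -/
theorem IsSymplectic.of_hasChartExpr_const [I.Boundaryless] [IsManifold I ∞ M]
    {η : DiffForm I M 2} (c : E [⋀^Fin 2]→L[ℝ] ℝ)
    (h : ∀ x₀ : M, HasChartExpr η x₀ (fun _ => c)) (hc : ∀ v, (∀ w, c ![v, w] = 0) → v = 0) :
    IsSymplectic I η where
  smooth x₀ := contDiffOn_const.congr (h x₀).inChart_eqOn
  closed := by
    funext x
    rw [(h x).d (differentiable_const c) x (mem_extChartAt_source x)]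
    have : extDeriv (fun _ : E => c) = 0 := by
      funext y
      ext v
      simp [extDeriv, ContinuousAlternatingMap.alternatizeUncurryFin_apply]
    rw [this]
    rfl
  nondegenerate x v hv := by
    refine hc v fun w => ?_
    have h1 : coef η x = coef (pullback I 𝓘(ℝ, E) (extChartAt I x) (ofModel fun _ => c)) x :=
      h x x (mem_extChartAt_source x)
    have h2 : coef η x ![v, w] = 0 := hv w
    rw [h1, coef_pullback, tderiv_extChartAt_self] at h2
    exact h2

end DiffForm
end Forms

/-! ### Induced charts of tangent and cotangent bundles -/

section BundleCharts

variable {E : Type*} [NormedAddCommGroup E] [NormedSpace ℝ E]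
  {H : Type*} [TopologicalSpace H] {I : ModelWithCorners ℝ E H}
  {M : Type*} [TopologicalSpace M] [ChartedSpace H M]

section General

variable {F : Type*} [NormedAddCommGroup F] [NormedSpace ℝ F] {V : M → Type*}
  [TopologicalSpace (TotalSpace F V)] [∀ x, TopologicalSpace (V x)] [FiberBundle F V]

theorem extChartAt_totalSpace_fst {v₀ v : TotalSpace F V}
    (hv : v ∈ (extChartAt (I.prod 𝓘(ℝ, F)) v₀).source) :
    (extChartAt (I.prod 𝓘(ℝ, F)) v₀ v).1 = extChartAt I v₀.proj v.proj := by
  rw [FiberBundle.extChartAt] at hv ⊢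
  simp only [mfld_simps] at hv ⊢
  rw [Trivialization.coe_fst _ (by simpa using hv.1)]

/-- Obtained by differentiating the fact that a bundle chart covers the base chart. -/
theorem fst_comp_tderiv_extChartAt [I.Boundaryless] [IsManifold I 1 M]
    [IsManifold (I.prod 𝓘(ℝ, F)) 1 (TotalSpace F V)] {v₀ v : TotalSpace F V}
    (hv : v ∈ (extChartAt (I.prod 𝓘(ℝ, F)) v₀).source)
    (hv' : v.proj ∈ (extChartAt I v₀.proj).source) :
    ContinuousLinearMap.fst ℝ E F ∘L
        tderiv (I.prod 𝓘(ℝ, F)) 𝓘(ℝ, E × F) (extChartAt (I.prod 𝓘(ℝ, F)) v₀) v =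
      tderiv I 𝓘(ℝ, E) (extChartAt I v₀.proj) v.proj ∘L
        tderiv (I.prod 𝓘(ℝ, F)) I (TotalSpace.proj : TotalSpace F V → M) v := by
  have h1 : MDifferentiableAt (I.prod 𝓘(ℝ, F)) I (TotalSpace.proj : TotalSpace F V → M) v :=
    (contMDiff_proj V (n := 1)).contMDiffAt.mdifferentiableAt (by simp)
  have h2 : MDifferentiableAt I 𝓘(ℝ, E) (extChartAt I v₀.proj) v.proj :=
    mdifferentiableAt_extChartAt (by simpa using hv')
  have h3 : MDifferentiableAt (I.prod 𝓘(ℝ, F)) 𝓘(ℝ, E × F) (extChartAt (I.prod 𝓘(ℝ, F)) v₀) v :=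
    mdifferentiableAt_extChartAt (by simpa only [extChartAt_source] using hv)
  rw [fst_comp_tderiv h3, ← tderiv_comp v h2 h1]
  apply tderiv_congr
  filter_upwards [extChartAt_source_mem_nhds' hv] with w hw using extChartAt_totalSpace_fst hw

theorem tderiv_totalSpace_proj [I.Boundaryless] [IsManifold I 1 M]
    [IsManifold (I.prod 𝓘(ℝ, F)) 1 (TotalSpace F V)] (v : TotalSpace F V) :
    tderiv (I.prod 𝓘(ℝ, F)) I (TotalSpace.proj : TotalSpace F V → M) v =
      ContinuousLinearMap.fst ℝ E F := by
  have := fst_comp_tderiv_extChartAt (I := I) (mem_extChartAt_source v)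
    (mem_extChartAt_source (I := I) v.proj)
  rw [tderiv_extChartAt_self, tderiv_extChartAt_self] at this
  exact this.symm

end General

/-- The coordinates of a tangent vector in the preferred chart at its base point. -/
def TangentBundle.vec (v : TangentBundle I M) : E := v.snd

/-- The coordinates of a covector in the preferred chart at its base point. -/
def CotangentBundle.covec (α : CotangentBundle I M) : E →L[ℝ] ℝ := α.snd

theorem TangentBundle.ext' {v w : TangentBundle I M} (h : v.proj = w.proj) (h' : vec v = vec w) :
    v = w := by
  obtain ⟨x, v⟩ := v
  obtain ⟨y, w⟩ := w
  obtain rfl : x = y := h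
  exact congrArg _ h'

theorem CotangentBundle.ext' {v w : CotangentBundle I M} (h : v.proj = w.proj)
    (h' : covec v = covec w) : v = w := by
  obtain ⟨x, v⟩ := v
  obtain ⟨y, w⟩ := w
  obtain rfl : x = y := h
  exact congrArg _ h'

variable [IsManifold I ∞ M]

theorem TangentBundle.mem_extChartAt_source_iff {v₀ v : TangentBundle I M} :
    v ∈ (extChartAt I.tangent v₀).source ↔ v.proj ∈ (extChartAt I v₀.proj).source := by
  rw [extChartAt_source, extChartAt_source, TangentBundle.mem_chart_source_iff]

theorem TangentBundle.extChartAt_apply {v₀ v : TangentBundle I M}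
    (hv : v.proj ∈ (extChartAt I v₀.proj).source) :
    extChartAt I.tangent v₀ v = (extChartAt I v₀.proj v.proj,
      tderiv I 𝓘(ℝ, E) (extChartAt I v₀.proj) v.proj v.vec) := by
  have h1 := TangentBundle.continuousLinearMapAt_trivializationAt (I := I) (x₀ := v₀.proj)
    (x := v.proj) (by simpa using hv)
  have h2 := TangentBundle.continuousLinearMapAt_trivializationAt_eq_core (I := I) (b₀ := v₀.proj)
    (b := v.proj) (by simpa using hv)
  refine Prod.ext (extChartAt_totalSpace_fst (TangentBundle.mem_extChartAt_source_iff.2 hv)) ?_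
  exact DFunLike.congr_fun (h2.symm.trans h1) v.snd

theorem CotangentBundle.mem_extChartAt_source_iff {v₀ v : CotangentBundle I M} :
    v ∈ (extChartAt I.cotangent v₀).source ↔ v.proj ∈ (extChartAt I v₀.proj).source := by
  rw [FiberBundle.extChartAt]
  simp only [mfld_simps]
  constructor
  · exact fun h => h.1.1
  · exact fun h => ⟨⟨h, trivial⟩, h⟩

/-- Covectors transform by the inverse of the derivative of the base chart: the trivialization of
the bundle of linear maps precomposes with the inverse trivialization of the tangent bundle and acts
trivially on the values in `ℝ`. -/
theorem CotangentBundle.extChartAt_apply {v₀ v : CotangentBundle I M}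
    (hv : v.proj ∈ (extChartAt I v₀.proj).source) [I.Boundaryless] :
    extChartAt I.cotangent v₀ v = (extChartAt I v₀.proj v.proj,
      v.covec ∘L
        tderiv 𝓘(ℝ, E) I (extChartAt I v₀.proj).symm (extChartAt I v₀.proj v.proj)) := by
  have h := TangentBundle.symmL_trivializationAt (I := I) (x₀ := v₀.proj)
    (x := v.proj) (by simpa using hv)
  refine Prod.ext (extChartAt_totalSpace_fst (CotangentBundle.mem_extChartAt_source_iff.2 hv)) ?_
  rw [FiberBundle.extChartAt]
  rw [I.range_eq_univ, mfderivWithin_univ] at h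
  ext w
  change (trivializationAt ℝ (Bundle.Trivial M ℝ) v₀.proj).continuousLinearMapAt ℝ v.proj
    (v.snd ((trivializationAt E (TangentSpace I) v₀.proj).symmL ℝ v.proj w)) = _
  refine Eq.trans (DFunLike.congr_fun (Bundle.Trivial.continuousLinearMapAt_trivialization
    ℝ M ℝ v.proj) _) ?_
  exact congrArg v.covec (DFunLike.congr_fun h w)

end BundleCharts

/-! ### Linear 1-forms and constant 2-forms on a vector space -/

section LinearForms

variable {F : Type*} [NormedAddCommGroup F] [NormedSpace ℝ F]

/-- The 1-form `x ↦ A x` with linear coefficients. -/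
def linForm (A : F →L[ℝ] F →L[ℝ] ℝ) (x : F) : F [⋀^Fin 1]→L[ℝ] ℝ :=
  ContinuousAlternatingMap.ofSubsingleton ℝ F ℝ (0 : Fin 1) (A x)

theorem linForm_apply (A : F →L[ℝ] F →L[ℝ] ℝ) (x : F) (v : Fin 1 → F) :
    linForm A x v = A x (v 0) := rfl

theorem contDiff_linForm (A : F →L[ℝ] F →L[ℝ] ℝ) : ContDiff ℝ ∞ (linForm A) :=
  (ContinuousAlternatingMap.ofSubsingletonLIE (𝕜 := ℝ) (E := F) (F := ℝ) (0 : Fin 1)).contDiff.comp A.contDiff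

theorem differentiable_linForm (A : F →L[ℝ] F →L[ℝ] ℝ) : Differentiable ℝ (linForm A) :=
  (contDiff_linForm A).differentiable (by simp)

/-- The constant 2-form `A (v, w) - A (w, v)`, the exterior derivative of `linForm A`. -/
def skewForm (A : F →L[ℝ] F →L[ℝ] ℝ) : F [⋀^Fin 2]→L[ℝ] ℝ :=
  ContinuousAlternatingMap.alternatizeUncurryFin (fderiv ℝ (linForm A) 0)

theorem extDeriv_linForm_apply (A : F →L[ℝ] F →L[ℝ] ℝ) (x : F) (v : Fin 2 → F) :
    extDeriv (linForm A) x v = A (v 0) (v 1) - A (v 1) (v 0) := by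
  rw [extDeriv_apply (differentiable_linForm A x)]
  have h (w : Fin 1 → F) (u : F) : fderiv ℝ (fun y => linForm A y w) x u = A u (w 0) := by
    have : (fun y => linForm A y w) = fun y => (A.flip (w 0)) y := by
      funext y; rfl
    rw [this, ContinuousLinearMap.fderiv]
    rfl
  simp only [h]
  simp [Fin.removeNth, sub_eq_add_neg]

theorem skewForm_apply (A : F →L[ℝ] F →L[ℝ] ℝ) (v : Fin 2 → F) :
    skewForm A v = A (v 0) (v 1) - A (v 1) (v 0) :=
  extDeriv_linForm_apply A 0 v

theorem extDeriv_linForm (A : F →L[ℝ] F →L[ℝ] ℝ) : extDeriv (linForm A) = fun _ => skewForm A := by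
  funext x
  ext v
  rw [extDeriv_linForm_apply, skewForm_apply]

/-- The bilinear form `((q, p), (u, w)) ↦ p u` on `F × F^*`. -/
def liouvilleBilin (F : Type*) [NormedAddCommGroup F] [NormedSpace ℝ F] :
    (F × (F →L[ℝ] ℝ)) →L[ℝ] (F × (F →L[ℝ] ℝ)) →L[ℝ] ℝ :=
  (ContinuousLinearMap.compL ℝ (F × (F →L[ℝ] ℝ)) F ℝ).flip
    (ContinuousLinearMap.fst ℝ F (F →L[ℝ] ℝ)) ∘L ContinuousLinearMap.snd ℝ F (F →L[ℝ] ℝ)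

theorem liouvilleBilin_apply (z w : F × (F →L[ℝ] ℝ)) : liouvilleBilin F z w = z.2 w.1 := rfl

/-- The bilinear form `((y, u), (X, Y)) ↦ A u X + A y Y`, the complete lift of `A`. -/
def tangentBilin (A : F →L[ℝ] F →L[ℝ] ℝ) : (F × F) →L[ℝ] (F × F) →L[ℝ] ℝ :=
  (ContinuousLinearMap.compL ℝ (F × F) F ℝ).flip (ContinuousLinearMap.fst ℝ F F) ∘L A ∘L
      ContinuousLinearMap.snd ℝ F F +
    (ContinuousLinearMap.compL ℝ (F × F) F ℝ).flip (ContinuousLinearMap.snd ℝ F F) ∘L A ∘L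
      ContinuousLinearMap.fst ℝ F F

theorem tangentBilin_apply (A : F →L[ℝ] F →L[ℝ] ℝ) (z w : F × F) :
    tangentBilin A z w = A z.2 w.1 + A z.1 w.2 := rfl

/-- The bilinear form `((y, u), (X, Y)) ↦ B u X`. -/
def verticalBilin (B : F →L[ℝ] F →L[ℝ] ℝ) : (F × F) →L[ℝ] (F × F) →L[ℝ] ℝ :=
  (ContinuousLinearMap.compL ℝ (F × F) F ℝ).flip (ContinuousLinearMap.fst ℝ F F) ∘L B ∘L
      ContinuousLinearMap.snd ℝ F F

theorem verticalBilin_apply (A : F →L[ℝ] F →L[ℝ] ℝ) (z w : F × F) :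
    verticalBilin A z w = A z.2 w.1 := rfl

/-- The opposite of a bilinear form. -/
def negBilin (A : F →L[ℝ] F →L[ℝ] ℝ) : F →L[ℝ] F →L[ℝ] ℝ := -A

theorem negBilin_apply (A : F →L[ℝ] F →L[ℝ] ℝ) (z w : F) : negBilin A z w = -A z w := rfl

theorem skewForm_negBilin (A : F →L[ℝ] F →L[ℝ] ℝ) : skewForm (negBilin A) = -skewForm A := by
  ext v
  simp [skewForm_apply, negBilin_apply]
  ring

theorem tangentBilin_negBilin (A : F →L[ℝ] F →L[ℝ] ℝ) :
    tangentBilin (negBilin A) = negBilin (tangentBilin A) := by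
  ext v w <;> simp [tangentBilin_apply, negBilin_apply]

/-- The bilinear form `((q, p), (u, w)) ↦ - p u` on `F × F^*`, whose skew-symmetrization is the
canonical symplectic form. -/
def canonicalBilin (F : Type*) [NormedAddCommGroup F] [NormedSpace ℝ F] :
    (F × (F →L[ℝ] ℝ)) →L[ℝ] (F × (F →L[ℝ] ℝ)) →L[ℝ] ℝ :=
  negBilin (liouvilleBilin F)

theorem canonicalBilin_apply (z w : F × (F →L[ℝ] ℝ)) : canonicalBilin F z w = -z.2 w.1 := rfl

theorem skewForm_canonicalBilin :
    skewForm (canonicalBilin F) = -skewForm (liouvilleBilin F) :=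
  skewForm_negBilin (liouvilleBilin F)

theorem skewForm_tangentBilin_canonicalBilin :
    skewForm (tangentBilin (canonicalBilin F)) =
      -skewForm (tangentBilin (liouvilleBilin F)) := by
  rw [canonicalBilin, tangentBilin_negBilin, skewForm_negBilin]

/-- Vertical test vectors detect the position component, because the dual separates points;
horizontal ones detect the momentum. -/
theorem skewForm_canonicalBilin_nondegenerate {z : F × (F →L[ℝ] ℝ)}
    (h : ∀ w, skewForm (canonicalBilin F) ![z, w] = 0) : z = 0 := by
  simp only [skewForm_apply, canonicalBilin_apply, Matrix.cons_val_zero, Matrix.cons_val_one] at h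
  refine Prod.ext ?_ ?_
  · refine SeparatingDual.eq_zero_of_forall_dual_eq_zero (R := ℝ) fun f => ?_
    simpa using h (0, f)
  · ext u
    simpa using h (u, 0)

/-- The complete lift pairs the first component of `z` with the second component of `w` and vice
versa, so test vectors with one zero component reduce this to the previous case. -/
theorem skewForm_tangentBilin_canonicalBilin_nondegenerate
    {z : (F × (F →L[ℝ] ℝ)) × (F × (F →L[ℝ] ℝ))}
    (h : ∀ w, skewForm (tangentBilin (canonicalBilin F)) ![z, w] = 0) : z = 0 := by
  simp only [skewForm_apply, tangentBilin_apply, canonicalBilin_apply, Matrix.cons_val_zero,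
    Matrix.cons_val_one] at h
  refine Prod.ext ?_ ?_
  · refine skewForm_canonicalBilin_nondegenerate fun w => ?_
    simpa [skewForm_apply, canonicalBilin_apply] using h (0, w)
  · refine skewForm_canonicalBilin_nondegenerate fun w => ?_
    simpa [skewForm_apply, canonicalBilin_apply] using h (w, 0)

/-- The two bilinear forms differ by `A z.1 w.2 + A w.1 z.2`, which is symmetric and so disappears
on skew-symmetrizing. The left side is what `d i_T` produces from the constant form `skewForm A`. -/
theorem skewForm_verticalBilin (A : F →L[ℝ] F →L[ℝ] ℝ) :
    skewForm (verticalBilin (A - A.flip)) = skewForm (tangentBilin A) := by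
  ext v
  simp [skewForm_apply, tangentBilin_apply, verticalBilin_apply]
  ring

end LinearForms

/-! ### Coordinate expressions of θ, ω and their images under d_T -/

section ChartExpressions

variable {E : Type*} [NormedAddCommGroup E] [NormedSpace ℝ E]
  {H : Type*} [TopologicalSpace H] {I : ModelWithCorners ℝ E H}
  {M : Type*} [TopologicalSpace M] [ChartedSpace H M] [I.Boundaryless] [IsManifold I ∞ M]
  {k : ℕ}

namespace DiffForm

theorem coef_liouvilleForm_apply (α : CotangentBundle I M) (v : Fin 1 → E × (E →L[ℝ] ℝ)) :
    coef (liouvilleForm I M) α v = α.covec (v 0).1 := by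
  have : tderiv I.cotangent I (cotangentProj I (M := M)) α = ContinuousLinearMap.fst ℝ E _ :=
    tderiv_totalSpace_proj α
  change α.covec (tderiv I.cotangent I (cotangentProj I (M := M)) α (v 0)) = _
  rw [this]
  rfl

/-- The chart acts on the covector by the inverse derivative and on the base part of the vector by
the derivative. The two cancel in the pairing, which is why θ is `p dq` in every induced chart. -/
theorem hasChartExpr_liouvilleForm (α₀ : CotangentBundle I M) :
    HasChartExpr (liouvilleForm I M) α₀ (linForm (liouvilleBilin E)) := by
  intro α hα
  have hα' := CotangentBundle.mem_extChartAt_source_iff.1 hα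
  apply coef_ext
  ext v
  rw [coef_liouvilleForm_apply, coef_pullback]
  have h1 := fst_comp_tderiv_extChartAt hα hα'
  rw [tderiv_totalSpace_proj] at h1
  have h2 := DFunLike.congr_fun h1 (v 0)
  have h3 := DFunLike.congr_fun (tderiv_extChartAt_symm_comp hα') (v 0).1
  simp only [ContinuousLinearMap.comp_apply, ContinuousLinearMap.coe_fst',
    ContinuousLinearMap.id_apply] at h2 h3
  rw [ContinuousAlternatingMap.compContinuousLinearMap_apply, coef_ofModel, linForm_apply,
    liouvilleBilin_apply, CotangentBundle.extChartAt_apply hα']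
  change α.covec _ = α.covec (tderiv 𝓘(ℝ, E) I (extChartAt I α₀.proj).symm
    (extChartAt I α₀.proj α.proj) (_ : E × _).1)
  rw [Function.comp_apply, h2, h3]

theorem hasChartExpr_canonicalForm (α₀ : CotangentBundle I M) :
    HasChartExpr (canonicalForm I M) α₀ (fun _ => skewForm (canonicalBilin E)) := by
  have := ((hasChartExpr_liouvilleForm α₀).d (differentiable_linForm _)).neg
  rw [extDeriv_linForm] at this
  rw [skewForm_canonicalBilin]
  exact this

theorem coef_iT_apply (η : DiffForm I M (k + 1)) (v : TangentBundle I M) (X : Fin k → E × E) :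
    coef (iT I η) v X = coef η v.proj (Matrix.vecCons v.vec fun i => (X i).1) := by
  have : tderiv I.tangent I (TotalSpace.proj : TangentBundle I M → M) v =
    ContinuousLinearMap.fst ℝ E E := tderiv_totalSpace_proj v
  change coef η v.proj (Matrix.vecCons v.vec
    fun i => tderiv I.tangent I (TotalSpace.proj : TangentBundle I M → M) v (X i)) = _
  rw [this]
  rfl

/-- The form `i_T η` for a form on the model vector space. -/
def iTModel (η : E → E [⋀^Fin (k + 1)]→L[ℝ] ℝ) (z : E × E) : (E × E) [⋀^Fin k]→L[ℝ] ℝ :=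
  ((η z.1).curryLeft z.2).compContinuousLinearMap (ContinuousLinearMap.fst ℝ E E)

/-- The chart of the tangent bundle applies the derivative of the base chart to the vector `v`, and
the same derivative acts on the projections of the `X i`, so all arguments of `η` transform alike.
-/
theorem HasChartExpr.iT {η : DiffForm I M (k + 1)} {v₀ : TangentBundle I M}
    {η₀ : E → E [⋀^Fin (k + 1)]→L[ℝ] ℝ} (h : HasChartExpr η v₀.proj η₀) :
    HasChartExpr (iT I η) v₀ (iTModel η₀) := by
  intro v hv
  have hv' := TangentBundle.mem_extChartAt_source_iff.1 hv
  have h1 := fst_comp_tderiv_extChartAt hv hv'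
  rw [tderiv_totalSpace_proj] at h1
  have h2 (X : E × E) : (tderiv I.tangent 𝓘(ℝ, E × E) (extChartAt I.tangent v₀) v X).1 =
    tderiv I 𝓘(ℝ, E) (extChartAt I v₀.proj) v.proj X.1 := DFunLike.congr_fun h1 X
  have h3 : coef η v.proj = coef (pullback I 𝓘(ℝ, E) (extChartAt I v₀.proj) (ofModel η₀)) v.proj :=
    h _ hv'
  apply coef_ext
  ext X
  rw [coef_iT_apply, h3, coef_pullback, coef_pullback,
    ContinuousAlternatingMap.compContinuousLinearMap_apply,
    ContinuousAlternatingMap.compContinuousLinearMap_apply,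
    TangentBundle.extChartAt_apply hv', coef_ofModel, coef_ofModel]
  change _ = η₀ (extChartAt I v₀.proj v.proj) (Matrix.vecCons
    (tderiv I 𝓘(ℝ, E) (extChartAt I v₀.proj) v.proj v.vec)
    (fun i => (tderiv I.tangent 𝓘(ℝ, E × E) (extChartAt I.tangent v₀) v (X i)).1))
  congr 1
  funext i
  refine Fin.cases ?_ (fun j => ?_) i
  · rfl
  · exact (h2 (X j)).symm

/-- At `(y, u)` and on `(X, Y)`, the term `i_T d` gives `A u X - A X u`, while `d i_T`, the
differential of the function `A y u`, gives `A X u + A y Y`. The terms `A X u` cancel. -/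
theorem HasChartExpr.dT_linForm {η : DiffForm I M 1} {v₀ : TangentBundle I M}
    {A : E →L[ℝ] E →L[ℝ] ℝ} (h : HasChartExpr η v₀.proj (linForm A)) :
    HasChartExpr (dT I η) v₀ (linForm (tangentBilin A)) := by
  have h1 := (h.d (differentiable_linForm _)).iT
  have hf (z : E × E) := A.hasFDerivAt_of_bilinear
    (hasFDerivAt_fst (𝕜 := ℝ) (p := z)) (hasFDerivAt_snd (𝕜 := ℝ) (p := z))
  have hi : iTModel (linForm A) = fun z : E × E =>
      ContinuousAlternatingMap.constOfIsEmpty ℝ _ (Fin 0) (A z.1 z.2) := by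
    funext z
    ext X
    simp [iTModel, linForm_apply]
  have hd : Differentiable ℝ (iTModel (linForm A)) := by
    rw [hi]
    exact (ContinuousAlternatingMap.constOfIsEmptyLIE ℝ (E × E) ℝ (Fin 0)).differentiable.comp
      fun z => (hf z).differentiableAt
  have h2 := h.iT.d hd
  have h3 : linForm (tangentBilin A) =
      iTModel (extDeriv (linForm A)) + extDeriv (iTModel (linForm A)) := by
    funext z
    ext X
    rw [Pi.add_apply, hi, extDeriv_linForm, extDeriv_constOfIsEmpty, (hf z).fderiv,
      ContinuousAlternatingMap.add_apply, linForm_apply, tangentBilin_apply]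
    simp [iTModel, skewForm_apply]
  rw [h3]
  exact h1.add h2

theorem extDeriv_const (c : E [⋀^Fin k]→L[ℝ] ℝ) : extDeriv (fun _ : E => c) = 0 := by
  funext y
  ext v
  simp [extDeriv, ContinuousAlternatingMap.alternatizeUncurryFin_apply]

/-- A constant form is closed, so only `d i_T` contributes. -/
theorem HasChartExpr.dT_skewForm {η : DiffForm I M 2} {v₀ : TangentBundle I M}
    {A : E →L[ℝ] E →L[ℝ] ℝ} (h : HasChartExpr η v₀.proj (fun _ => skewForm A)) :
    HasChartExpr (dT I η) v₀ (fun _ => skewForm (tangentBilin A)) := by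
  have h1 := (h.d (differentiable_const _)).iT
  have hi : iTModel (fun _ : E => skewForm A) = linForm (verticalBilin (A - A.flip)) := by
    funext z
    ext X
    simp [iTModel, linForm_apply, verticalBilin_apply, skewForm_apply]
  have h2 := h.iT.d (by rw [hi]; exact differentiable_linForm _)
  rw [hi, extDeriv_linForm, skewForm_verticalBilin] at h2
  have h3 : (fun _ : E × E => skewForm (tangentBilin A)) =
      iTModel (extDeriv fun _ : E => skewForm A) + fun _ => skewForm (tangentBilin A) := by
    funext z
    ext X
    rw [extDeriv_const]
    simp [iTModel]
  rw [h3]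
  exact h1.add h2

theorem hasChartExpr_dT_liouvilleForm (v₀ : TangentBundle I.cotangent (CotangentBundle I M)) :
    HasChartExpr (dT I.cotangent (liouvilleForm I M)) v₀
      (linForm (tangentBilin (liouvilleBilin E))) :=
  (hasChartExpr_liouvilleForm v₀.proj).dT_linForm

theorem hasChartExpr_dT_canonicalForm (v₀ : TangentBundle I.cotangent (CotangentBundle I M)) :
    HasChartExpr (dT I.cotangent (canonicalForm I M)) v₀
      (fun _ => skewForm (tangentBilin (canonicalBilin E))) :=
  (hasChartExpr_canonicalForm v₀.proj).dT_skewForm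

/-- `d_T ω = - d (d_T θ)`. -/
theorem dT_canonicalForm_eq (v : TangentBundle I.cotangent (CotangentBundle I M)) :
    dT I.cotangent (canonicalForm I M) v =
      -d I.cotangent.tangent (dT I.cotangent (liouvilleForm I M)) v := by
  -- Both sides have constant coefficients in the same chart, so it suffices to compare these.
  have h := ((hasChartExpr_dT_liouvilleForm v).d (differentiable_linForm _)).neg v
    (mem_extChartAt_source v)
  rw [extDeriv_linForm] at h
  rw [hasChartExpr_dT_canonicalForm v v (mem_extChartAt_source v), 
    skewForm_tangentBilin_canonicalBilin]
  exact h.symm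

theorem isSymplectic_dT_canonicalForm :
    IsSymplectic I.cotangent.tangent (dT I.cotangent (canonicalForm I M)) :=
  IsSymplectic.of_hasChartExpr_const _ hasChartExpr_dT_canonicalForm 
    fun _ => skewForm_tangentBilin_canonicalBilin_nondegenerate

end DiffForm

end ChartExpressions

/-! ### Forms pulled back from the factors of a product -/

section Products

variable {E : Type*} [NormedAddCommGroup E] [NormedSpace ℝ E]
  {H : Type*} [TopologicalSpace H] {I : ModelWithCorners ℝ E H}
  {M : Type*} [TopologicalSpace M] [ChartedSpace H M]
  {E' : Type*} [NormedAddCommGroup E'] [NormedSpace ℝ E']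
  {H' : Type*} [TopologicalSpace H'] {J : ModelWithCorners ℝ E' H'}
  {N : Type*} [TopologicalSpace N] [ChartedSpace H' N] {k : ℕ}

namespace DiffForm

theorem tderiv_extChartAt_prod [IsManifold I 1 M] [IsManifold J 1 N] {z₀ z : M × N}
    (h1 : z.1 ∈ (extChartAt I z₀.1).source) (h2 : z.2 ∈ (extChartAt J z₀.2).source) :
    tderiv (I.prod J) 𝓘(ℝ, E × E') (extChartAt (I.prod J) z₀) z =
      (tderiv I 𝓘(ℝ, E) (extChartAt I z₀.1) z.1).prodMap
        (tderiv J 𝓘(ℝ, E') (extChartAt J z₀.2) z.2) := by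
  have h1' : MDifferentiableAt I 𝓘(ℝ, E) (extChartAt I z₀.1) z.1 :=
    mdifferentiableAt_extChartAt (by simpa using h1)
  have h2' : MDifferentiableAt J 𝓘(ℝ, E') (extChartAt J z₀.2) z.2 :=
    mdifferentiableAt_extChartAt (by simpa using h2)
  have h : MDifferentiableAt (I.prod J) 𝓘(ℝ, E × E') (extChartAt (I.prod J) z₀) z :=
    mdifferentiableAt_extChartAt (by
      rw [← extChartAt_source (I.prod J), extChartAt_prod]; exact ⟨h1, h2⟩)
  have hfst : ContinuousLinearMap.fst ℝ E E' ∘L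
      tderiv (I.prod J) 𝓘(ℝ, E × E') (extChartAt (I.prod J) z₀) z =
      tderiv I 𝓘(ℝ, E) (extChartAt I z₀.1) z.1 ∘L ContinuousLinearMap.fst ℝ E E' := by
    rw [fst_comp_tderiv h, ← tderiv_fst (I := I) (J := J) z, ← tderiv_comp z h1' mdifferentiableAt_fst,
      extChartAt_prod]
    rfl
  have hsnd : ContinuousLinearMap.snd ℝ E E' ∘L
      tderiv (I.prod J) 𝓘(ℝ, E × E') (extChartAt (I.prod J) z₀) z =
      tderiv J 𝓘(ℝ, E') (extChartAt J z₀.2) z.2 ∘L ContinuousLinearMap.snd ℝ E E' := by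
    rw [snd_comp_tderiv h, ← tderiv_snd (I := I) (J := J) z, ← tderiv_comp z h2' mdifferentiableAt_snd,
      extChartAt_prod]
    rfl
  exact ContinuousLinearMap.ext fun v =>
    Prod.ext (DFunLike.congr_fun hfst v) (DFunLike.congr_fun hsnd v)

theorem HasChartExpr.pullback_fst [IsManifold I 1 M] [IsManifold J 1 N] {η : DiffForm I M k}
    {z₀ : M × N} {η₀ : E → E [⋀^Fin k]→L[ℝ] ℝ} (h : HasChartExpr η z₀.1 η₀) :
    HasChartExpr (pullback (I.prod J) I (Prod.fst : M × N → M) η) z₀ (fun z =>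
      (η₀ z.1).compContinuousLinearMap (ContinuousLinearMap.fst ℝ E E')) := by
  intro z hz
  rw [extChartAt_prod] at hz
  have h1 : coef η z.1 = coef (pullback I 𝓘(ℝ, E) (extChartAt I z₀.1) (ofModel η₀)) z.1 :=
    h _ hz.1
  apply coef_ext
  rw [coef_pullback, coef_pullback, tderiv_extChartAt_prod hz.1 hz.2, tderiv_fst, h1, extChartAt_prod]
  rfl

theorem HasChartExpr.pullback_snd [IsManifold I 1 M] [IsManifold J 1 N] {η : DiffForm J N k}
    {z₀ : M × N} {η₀ : E' → E' [⋀^Fin k]→L[ℝ] ℝ} (h : HasChartExpr η z₀.2 η₀) :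
    HasChartExpr (pullback (I.prod J) J (Prod.snd : M × N → N) η) z₀ (fun z =>
      (η₀ z.2).compContinuousLinearMap (ContinuousLinearMap.snd ℝ E E')) := by
  intro z hz
  rw [extChartAt_prod] at hz
  have h1 : coef η z.2 = coef (pullback J 𝓘(ℝ, E') (extChartAt J z₀.2) (ofModel η₀)) z.2 :=
    h _ hz.2
  apply coef_ext
  rw [coef_pullback, coef_pullback, tderiv_extChartAt_prod hz.1 hz.2, tderiv_snd, h1, extChartAt_prod]
  rfl

end DiffForm

/-- The bilinear form `A ∘ pr₂ - A ∘ pr₁` on `F × F`. -/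
def diffBilin {F : Type*} [NormedAddCommGroup F] [NormedSpace ℝ F] (A : F →L[ℝ] F →L[ℝ] ℝ) :
    (F × F) →L[ℝ] (F × F) →L[ℝ] ℝ :=
  A.bilinearComp (ContinuousLinearMap.snd ℝ F F) (ContinuousLinearMap.snd ℝ F F) -
    A.bilinearComp (ContinuousLinearMap.fst ℝ F F) (ContinuousLinearMap.fst ℝ F F)

theorem diffBilin_apply {F : Type*} [NormedAddCommGroup F] [NormedSpace ℝ F]
    (A : F →L[ℝ] F →L[ℝ] ℝ) (z w : F × F) : diffBilin A z w = A z.2 w.2 - A z.1 w.1 := rfl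

theorem skewForm_diffBilin_negBilin {F : Type*} [NormedAddCommGroup F] [NormedSpace ℝ F]
    (A : F →L[ℝ] F →L[ℝ] ℝ) : skewForm (diffBilin (negBilin A)) = -skewForm (diffBilin A) := by
  ext v
  simp [skewForm_apply, diffBilin_apply, negBilin_apply]
  ring

theorem skewForm_diffBilin_canonicalBilin_nondegenerate
    {F : Type*} [NormedAddCommGroup F] [NormedSpace ℝ F]
    {z : (F × (F →L[ℝ] ℝ)) × (F × (F →L[ℝ] ℝ))}
    (h : ∀ w, skewForm (diffBilin (canonicalBilin F)) ![z, w] = 0) : z = 0 := by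
  simp only [skewForm_apply, diffBilin_apply, canonicalBilin_apply, Matrix.cons_val_zero,
    Matrix.cons_val_one] at h
  refine Prod.ext ?_ ?_
  · refine skewForm_canonicalBilin_nondegenerate fun w => ?_
    have := h (w, 0)
    simp [skewForm_apply, canonicalBilin_apply] at this ⊢
    linarith
  · refine skewForm_canonicalBilin_nondegenerate fun w => ?_
    simpa [skewForm_apply, canonicalBilin_apply] using h (0, w)

end Products

/-! ### The forms θ₁₂ and Ω₁₂ -/

section CotangentProduct

variable {E : Type*} [NormedAddCommGroup E] [NormedSpace ℝ E]
  {H : Type*} [TopologicalSpace H] {I : ModelWithCorners ℝ E H}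
  {M : Type*} [TopologicalSpace M] [ChartedSpace H M] [I.Boundaryless] [IsManifold I ∞ M]

variable (I M) in
/-- The 1-form `θ₁₂ = pr₂^* θ_M - pr₁^* θ_M` on `T^*M × T^*M`. -/
def theta12 :
    DiffForm (I.cotangent.prod I.cotangent) (CotangentBundle I M × CotangentBundle I M) 1 :=
  DiffForm.pullback (I.cotangent.prod I.cotangent) I.cotangent Prod.snd (liouvilleForm I M)
    - DiffForm.pullback (I.cotangent.prod I.cotangent) I.cotangent Prod.fst (liouvilleForm I M)

namespace DiffForm

theorem hasChartExpr_theta12 (a : CotangentBundle I M × CotangentBundle I M) :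
    HasChartExpr (theta12 I M) a (linForm (diffBilin (liouvilleBilin E))) := by
  have h1 := (hasChartExpr_liouvilleForm a.1).pullback_fst (z₀ := a) (J := I.cotangent)
  have h2 := (hasChartExpr_liouvilleForm a.2).pullback_snd (z₀ := a) (I := I.cotangent)
  exact h2.sub h1

theorem hasChartExpr_omega12 (a : CotangentBundle I M × CotangentBundle I M) :
    HasChartExpr (omega12 I M) a (fun _ => skewForm (diffBilin (canonicalBilin E))) := by
  have h1 := (hasChartExpr_canonicalForm a.1).pullback_fst (z₀ := a) (J := I.cotangent)
  have h2 := (hasChartExpr_canonicalForm a.2).pullback_snd (z₀ := a) (I := I.cotangent)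
  have h3 := h2.sub h1
  have h4 : (fun _ : (E × (E →L[ℝ] ℝ)) × (E × (E →L[ℝ] ℝ)) =>
      skewForm (diffBilin (canonicalBilin E))) = (fun z =>
      (skewForm (canonicalBilin E)).compContinuousLinearMap (ContinuousLinearMap.snd ℝ _ _))
      - (fun z => (skewForm (canonicalBilin E)).compContinuousLinearMap
        (ContinuousLinearMap.fst ℝ _ _)) := by
    funext z
    ext v
    simp [skewForm_apply, diffBilin_apply, ContinuousAlternatingMap.sub_apply]
    ring
  rw [h4]
  exact h3

/-- `Ω₁₂ = - d θ₁₂`. -/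
theorem omega12_eq (a : CotangentBundle I M × CotangentBundle I M) :
    omega12 I M a = -d (I.cotangent.prod I.cotangent) (theta12 I M) a := by
  have h := ((hasChartExpr_theta12 a).d (differentiable_linForm _)).neg a
    (mem_extChartAt_source a)
  rw [extDeriv_linForm] at h
  rw [hasChartExpr_omega12 a a (mem_extChartAt_source a), canonicalBilin,
    skewForm_diffBilin_negBilin]
  exact h.symm

theorem isSymplectic_omega12 : IsSymplectic (I.cotangent.prod I.cotangent) (omega12 I M) :=
  IsSymplectic.of_hasChartExpr_const _ hasChartExpr_omega12
    fun _ => skewForm_diffBilin_canonicalBilin_nondegenerate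

end DiffForm

end CotangentProduct

/-! ### Cotangent lifts of local diffeomorphisms preserve the Liouville form -/

section CotangentLifts

variable {E : Type*} [NormedAddCommGroup E] [NormedSpace ℝ E]
  {H : Type*} [TopologicalSpace H] {I : ModelWithCorners ℝ E H}
  {M : Type*} [TopologicalSpace M] [ChartedSpace H M]
  {E' : Type*} [NormedAddCommGroup E'] [NormedSpace ℝ E']
  {H' : Type*} [TopologicalSpace H'] {J : ModelWithCorners ℝ E' H'}
  {N : Type*} [TopologicalSpace N] [ChartedSpace H' N]
  {E'' : Type*} [NormedAddCommGroup E''] [NormedSpace ℝ E'']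
  {H'' : Type*} [TopologicalSpace H''] {K : ModelWithCorners ℝ E'' H''}
  {P : Type*} [TopologicalSpace P] [ChartedSpace H'' P]

theorem covec_cotangentHat (F : M → N) (α : CotangentBundle I M) :
    (cotangentHat I J F α).covec = α.covec ∘L (tderiv I J F α.proj).inverse := rfl

variable [I.Boundaryless] [IsManifold I ∞ M] [J.Boundaryless] [IsManifold J ∞ N]

theorem CotangentBundle.extChartAt_snd_comp {α₀ α : CotangentBundle I M}
    (hα : α.proj ∈ (extChartAt I α₀.proj).source) :
    (extChartAt I.cotangent α₀ α).2 ∘L tderiv I 𝓘(ℝ, E) (extChartAt I α₀.proj) α.proj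
      = α.covec := by
  rw [CotangentBundle.extChartAt_apply hα, ContinuousLinearMap.comp_assoc,
    tderiv_extChartAt_symm_comp hα]
  rfl

theorem CotangentBundle.extChartAt_snd_eq {α₀ α : CotangentBundle I M}
    (hα : α.proj ∈ (extChartAt I α₀.proj).source) {m : E →L[ℝ] ℝ}
    (h : m ∘L tderiv I 𝓘(ℝ, E) (extChartAt I α₀.proj) α.proj = α.covec) :
    (extChartAt I.cotangent α₀ α).2 = m := by
  rw [CotangentBundle.extChartAt_apply hα, ← h, ContinuousLinearMap.comp_assoc,
    tderiv_extChartAt_comp hα]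
  rfl

/-- A map into the cotangent bundle is smooth if its base map and the coordinates of the covectors
are. -/
theorem CotangentBundle.contMDiffAt_of_coordinates {f : P → CotangentBundle I M} {x₀ : P}
    (h1 : ContMDiffAt K I ∞ (fun x => (f x).proj) x₀) {m : P → E →L[ℝ] ℝ}
    (h2 : ContMDiffAt K 𝓘(ℝ, E →L[ℝ] ℝ) ∞ m x₀)
    (h3 : ∀ᶠ x in 𝓝 x₀, m x ∘L tderiv I 𝓘(ℝ, E) (extChartAt I (f x₀).proj) (f x).proj
      = (f x).covec) :
    ContMDiffAt K I.cotangent ∞ f x₀ := by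
  refine contMDiffAt_totalSpace.2 ⟨h1, h2.congr_of_eventuallyEq ?_⟩
  have h4 : ∀ᶠ x in 𝓝 x₀, (f x).proj ∈ (extChartAt I (f x₀).proj).source :=
    h1.continuousAt.preimage_mem_nhds (extChartAt_source_mem_nhds _)
  filter_upwards [h3, h4] with x h h'
  rw [← CotangentBundle.extChartAt_snd_eq h' h, FiberBundle.extChartAt]
  rfl

/-- In coordinates the map is `(q, p) ↦ (F q, p ∘ (DF q)⁻¹)`, and inversion of operators is smooth
near an invertible one. -/
theorem contMDiffAt_cotangentHat [CompleteSpace E] {F : M → N} {α₀ : CotangentBundle I M}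
    (hF : ContMDiffAt I J ∞ F α₀.proj) (hinv : (tderiv I J F α₀.proj).IsInvertible) :
    ContMDiffAt I.cotangent J.cotangent ∞ (cotangentHat I J F) α₀ := by
  have hc : ContDiffAt ℝ ∞ (writtenInExtChartAt I J α₀.proj F) (extChartAt I α₀.proj α₀.proj) := by
    have := (contMDiffAt_iff.1 hF).2
    rw [I.range_eq_univ] at this
    exact this.contDiffAt Filter.univ_mem
  have hproj : ContMDiffAt I.cotangent I ∞ (cotangentProj I (M := M)) α₀ := contMDiffAt_proj _
  have hch : ContMDiffAt I.cotangent 𝓘(ℝ, E × (E →L[ℝ] ℝ)) ∞ (extChartAt I.cotangent α₀) α₀ :=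
    contMDiffAt_extChartAt
  have h1 : ContMDiffAt I.cotangent J ∞ (fun α => (cotangentHat I J F α).proj) α₀ :=
    hF.comp α₀ hproj
  have hfd : ContDiffAt ℝ ∞ (fun y => (fderiv ℝ (writtenInExtChartAt I J α₀.proj F) y).inverse)
      (extChartAt I.cotangent α₀ α₀).1 := by
    rw [CotangentBundle.extChartAt_apply (mem_extChartAt_source _)]
    refine ContDiffAt.comp (extChartAt I α₀.proj α₀.proj) (g := ContinuousLinearMap.inverse) ?_
      (hc.fderiv_right (m := ∞) (by simp))
    apply ContinuousLinearMap.IsInvertible.contDiffAt_map_inverse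
    rwa [← tderiv_eq_fderiv_writtenInExtChartAt (hF.mdifferentiableAt (by simp))]
  refine CotangentBundle.contMDiffAt_of_coordinates h1 (m := fun α =>
    (extChartAt I.cotangent α₀ α).2 ∘L
      (fderiv ℝ (writtenInExtChartAt I J α₀.proj F) (extChartAt I.cotangent α₀ α).1).inverse) ?_ ?_
  · refine ContMDiffAt.clm_comp ?_ ?_
    · exact (contDiffAt_snd (𝕜 := ℝ)).contMDiffAt.comp α₀ hch
    · exact (hfd.comp _ (contDiffAt_fst (𝕜 := ℝ))).contMDiffAt.comp α₀ hch
  · have e1 : ∀ᶠ α in 𝓝 α₀, α.proj ∈ (extChartAt I α₀.proj).source :=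
      hproj.continuousAt.preimage_mem_nhds (extChartAt_source_mem_nhds _)
    have e2 : ∀ᶠ α in 𝓝 α₀, F α.proj ∈ (extChartAt J (F α₀.proj)).source :=
      h1.continuousAt.preimage_mem_nhds (extChartAt_source_mem_nhds _)
    have e3 : ∀ᶠ α : CotangentBundle I M in 𝓝 α₀, MDifferentiableAt I J F α.proj := by
      refine hproj.continuousAt.preimage_mem_nhds (t := {z | MDifferentiableAt I J F z}) ?_
      have h1 : ContMDiffAt I J 1 F α₀.proj := hF.of_le (by norm_cast)
      filter_upwards [(contMDiffAt_iff_contMDiffAt_nhds (by simp)).1 h1] with z hz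
        using hz.mdifferentiableAt (by simp)
    filter_upwards [e1, e2, e3] with α h1 h2 h3
    rw [covec_cotangentHat, CotangentBundle.extChartAt_apply h1]
    change ((α.covec ∘L _) ∘L (fderiv ℝ _ (extChartAt I α₀.proj α.proj)).inverse) ∘L
      tderiv J 𝓘(ℝ, E') (extChartAt J (F α₀.proj)) (F α.proj) = _
    have hJ := isInvertible_tderiv_extChartAt h2
    have hI : (tderiv 𝓘(ℝ, E) I (extChartAt I α₀.proj).symm (extChartAt I α₀.proj α.proj)).IsInvertible :=
      .of_inverse (tderiv_extChartAt_symm_comp h1) (tderiv_extChartAt_comp h1)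
    -- Only the two chart factors have to be invertible here: where `T F` is not, `inverse` takes
    -- its default value 0 on both sides.
    rw [fderiv_writtenInExtChartAt h1 h2 h3, hJ.inverse_comp_of_left, hI.inverse_comp_of_right]
    ext w
    simp only [ContinuousLinearMap.comp_apply]
    rw [hJ.inverse_apply_self, hI.self_apply_inverse]

/-- `\hat F^* θ_N = θ_M`. -/
theorem pullback_cotangentHat_liouvilleForm [CompleteSpace E] {F : M → N} {α : CotangentBundle I M}
    (hF : ContMDiffAt I J ∞ F α.proj) (hinv : (tderiv I J F α.proj).IsInvertible) :
    DiffForm.pullback I.cotangent J.cotangent (cotangentHat I J F) (liouvilleForm J N) α =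
      liouvilleForm I M α := by
  have hs := (contMDiffAt_cotangentHat hF hinv).mdifferentiableAt (by simp)
  have hp : MDifferentiableAt I.cotangent I (cotangentProj I (M := M)) α :=
    (contMDiffAt_proj _ (n := 1)).mdifferentiableAt (by simp)
  have hp' : MDifferentiableAt J.cotangent J (cotangentProj J (M := N)) (cotangentHat I J F α) :=
    (contMDiffAt_proj _ (n := 1)).mdifferentiableAt (by simp)
  have h := tderiv_comp α hp' hs
  have h' := tderiv_comp α (hF.mdifferentiableAt (by simp) : MDifferentiableAt I J F
    (cotangentProj I (M := M) α)) hp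
  -- The derivative of π_N ∘ `\hat F` = F ∘ π_M. The factor `T F` it produces cancels the inverse in
  -- the covector of `\hat F α`.
  have h'' := h.symm.trans h'
  apply DiffForm.coef_ext
  ext v
  have h3 := DFunLike.congr_fun h'' (v 0)
  rw [tderiv_totalSpace_proj, tderiv_totalSpace_proj] at h3
  rw [DiffForm.coef_pullback, ContinuousAlternatingMap.compContinuousLinearMap_apply,
    DiffForm.coef_liouvilleForm_apply, DiffForm.coef_liouvilleForm_apply, covec_cotangentHat]
  change α.covec ((tderiv I J F α.proj).inverse _) = _
  refine congrArg α.covec ?_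
  exact (congrArg _ h3).trans (hinv.inverse_apply_self ..)

end CotangentLifts

/-! ### The identification Φ of T^*M × T^*M with T^*(M × M) -/

section Phi

variable {E : Type*} [NormedAddCommGroup E] [NormedSpace ℝ E]
  {H : Type*} [TopologicalSpace H] {I : ModelWithCorners ℝ E H}
  {M : Type*} [TopologicalSpace M] [ChartedSpace H M]

theorem covec_cotangentPhi_symm_fst (γ : CotangentBundle (I.prod I) (M × M)) :
    ((cotangentPhi I).symm γ).1.covec = -γ.covec ∘L ContinuousLinearMap.inl ℝ E E := rfl

theorem covec_cotangentPhi_symm_snd (γ : CotangentBundle (I.prod I) (M × M)) :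
    ((cotangentPhi I).symm γ).2.covec = γ.covec ∘L ContinuousLinearMap.inr ℝ E E := rfl

variable [I.Boundaryless] [IsManifold I ∞ M]

/-- The derivative of a product chart is block diagonal, so restricting a covector to either factor
has the same form in coordinates. -/
theorem contMDiff_cotangentPhi_symm :
    ContMDiff (I.prod I).cotangent (I.cotangent.prod I.cotangent) ∞
      (cotangentPhi I (M := M)).symm := by
  intro γ₀
  have hproj : ContMDiffAt (I.prod I).cotangent (I.prod I) ∞ (cotangentProj (I.prod I) (M := M × M))
    γ₀ := contMDiffAt_proj _
  have hch : ContMDiffAt (I.prod I).cotangent 𝓘(ℝ, (E × E) × ((E × E) →L[ℝ] ℝ)) ∞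
    (extChartAt (I.prod I).cotangent γ₀) γ₀ := contMDiffAt_extChartAt
  have hch2 : ContMDiffAt (I.prod I).cotangent 𝓘(ℝ, (E × E) →L[ℝ] ℝ) ∞
      (fun γ => (extChartAt (I.prod I).cotangent γ₀ γ).2) γ₀ :=
    (contDiffAt_snd (𝕜 := ℝ)).contMDiffAt.comp γ₀ hch
  have e : ∀ᶠ γ : CotangentBundle (I.prod I) (M × M) in 𝓝 γ₀,
      γ.proj ∈ (extChartAt (I.prod I) γ₀.proj).source :=
    hproj.continuousAt.preimage_mem_nhds (extChartAt_source_mem_nhds _)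
  have e' : ∀ᶠ γ : CotangentBundle (I.prod I) (M × M) in 𝓝 γ₀,
      (extChartAt (I.prod I).cotangent γ₀ γ).2 ∘L
      (tderiv I 𝓘(ℝ, E) (extChartAt I γ₀.proj.1) γ.proj.1).prodMap
        (tderiv I 𝓘(ℝ, E) (extChartAt I γ₀.proj.2) γ.proj.2) = γ.covec := by
    filter_upwards [e] with γ hγ
    have h := CotangentBundle.extChartAt_snd_comp hγ
    rw [extChartAt_prod] at hγ
    rwa [DiffForm.tderiv_extChartAt_prod hγ.1 hγ.2] at h
  refine ContMDiffAt.prodMk (f := fun γ => ((cotangentPhi I (M := M)).symm γ).1)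
    (g := fun γ => ((cotangentPhi I (M := M)).symm γ).2) ?_ ?_
  · refine CotangentBundle.contMDiffAt_of_coordinates
      (m := fun γ => -(extChartAt (I.prod I).cotangent γ₀ γ).2 ∘L ContinuousLinearMap.inl ℝ E E)
      (contMDiffAt_fst.comp γ₀ hproj) ?_ ?_
    · exact (ContMDiffAt.clm_comp hch2 contMDiffAt_const).neg
    · filter_upwards [e'] with γ h
      rw [covec_cotangentPhi_symm_fst, ← h]
      ext u
      simp
      rfl
  · refine CotangentBundle.contMDiffAt_of_coordinates
      (m := fun γ => (extChartAt (I.prod I).cotangent γ₀ γ).2 ∘L ContinuousLinearMap.inr ℝ E E)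
      (contMDiffAt_snd.comp γ₀ hproj) ?_ ?_
    · exact ContMDiffAt.clm_comp hch2 contMDiffAt_const
    · filter_upwards [e'] with γ h
      rw [covec_cotangentPhi_symm_snd, ← h]
      ext u
      simp
      rfl

/-- `(Φ⁻¹)^* θ₁₂ = θ_{M × M}`. -/
theorem pullback_cotangentPhi_symm_theta12 (γ : CotangentBundle (I.prod I) (M × M)) :
    DiffForm.pullback (I.prod I).cotangent (I.cotangent.prod I.cotangent)
      (cotangentPhi I (M := M)).symm (theta12 I M) γ = liouvilleForm (I.prod I) (M × M) γ := by
  have hs : MDifferentiableAt (I.prod I).cotangent (I.cotangent.prod I.cotangent)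
      (cotangentPhi I (M := M)).symm γ :=
    contMDiff_cotangentPhi_symm.contMDiffAt.mdifferentiableAt (by simp)
  have hp : MDifferentiableAt (I.prod I).cotangent (I.prod I)
      (cotangentProj (I.prod I) (M := M × M)) γ :=
    (contMDiffAt_proj _ (n := 1)).mdifferentiableAt (by simp)
  have hp' (α : CotangentBundle I M) : MDifferentiableAt I.cotangent I (cotangentProj I (M := M)) α :=
    (contMDiffAt_proj _ (n := 1)).mdifferentiableAt (by simp)
  set a := (cotangentPhi I (M := M)).symm γ with ha
  -- θ₁₂ sees only the base components of T(Φ⁻¹), which follow by differentiating π_M ∘ pr_i ∘ Φ⁻¹ =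
  -- pr_i ∘ π_{M×M}.
  have h1 : ContinuousLinearMap.fst ℝ E _ ∘L ContinuousLinearMap.fst ℝ _ _ ∘L
      tderiv (I.prod I).cotangent (I.cotangent.prod I.cotangent) (cotangentPhi I (M := M)).symm γ =
      ContinuousLinearMap.fst ℝ E E ∘L ContinuousLinearMap.fst ℝ (E × E) ((E × E) →L[ℝ] ℝ) := by
    have h1 := tderiv_comp γ (mdifferentiableAt_fst (I := I.cotangent) (I' := I.cotangent)) hs
    have h2 := tderiv_comp γ (hp' _) (mdifferentiableAt_fst.comp γ hs)
    have h3 := tderiv_comp γ (mdifferentiableAt_fst (I := I) (I' := I)) hp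
    have h4 := h2.symm.trans h3
    rw [h1, tderiv_totalSpace_proj, tderiv_totalSpace_proj, tderiv_fst, tderiv_fst] at h4
    exact h4
  have h2 : ContinuousLinearMap.fst ℝ E _ ∘L ContinuousLinearMap.snd ℝ _ _ ∘L
      tderiv (I.prod I).cotangent (I.cotangent.prod I.cotangent) (cotangentPhi I (M := M)).symm γ =
      ContinuousLinearMap.snd ℝ E E ∘L ContinuousLinearMap.fst ℝ (E × E) ((E × E) →L[ℝ] ℝ) := by
    have h1 := tderiv_comp γ (mdifferentiableAt_snd (I := I.cotangent) (I' := I.cotangent)) hs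
    have h2 := tderiv_comp γ (hp' _) (mdifferentiableAt_snd.comp γ hs)
    have h3 := tderiv_comp γ (mdifferentiableAt_snd (I := I) (I' := I)) hp
    have h4 := h2.symm.trans h3
    rw [h1, tderiv_totalSpace_proj, tderiv_totalSpace_proj, tderiv_snd, tderiv_snd] at h4
    exact h4
  apply DiffForm.coef_ext
  ext v
  have h1' := DFunLike.congr_fun h1 (v 0)
  have h2' := DFunLike.congr_fun h2 (v 0)
  rw [DiffForm.coef_pullback, ContinuousAlternatingMap.compContinuousLinearMap_apply, theta12,
    DiffForm.coef_sub, ContinuousAlternatingMap.sub_apply, DiffForm.coef_pullback,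
    DiffForm.coef_pullback, ContinuousAlternatingMap.compContinuousLinearMap_apply,
    ContinuousAlternatingMap.compContinuousLinearMap_apply, tderiv_fst, tderiv_snd,
    DiffForm.coef_liouvilleForm_apply, DiffForm.coef_liouvilleForm_apply,
    DiffForm.coef_liouvilleForm_apply, ← ha, covec_cotangentPhi_symm_fst,
    covec_cotangentPhi_symm_snd]
  -- The minus sign of θ₁₂ meets the minus sign in Φ.
  change γ.covec (0, _) - -γ.covec (_, 0) = γ.covec (v 0).1
  rw [sub_neg_eq_add, ← map_add]
  refine congrArg γ.covec (Prod.ext ?_ ?_)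
  · simpa using h1'
  · simpa using h2'

end Phi

/-! ### Tulczyjew's map and the form d_T θ -/

section Tulczyjew

variable {E : Type*} [NormedAddCommGroup E] [NormedSpace ℝ E]
  {H : Type*} [TopologicalSpace H] {I : ModelWithCorners ℝ E H}
  {M : Type*} [TopologicalSpace M] [ChartedSpace H M] [IsManifold I ∞ M]

variable (I M) in
/-- The tangent map `Tπ_M : TT^*M → TM` of the projection of the cotangent bundle. -/
abbrev tangentProj : TangentBundle I.cotangent (CotangentBundle I M) → TangentBundle I M :=
  tangentMap I.cotangent I (cotangentProj I (M := M))

theorem covec_tulczyjewAlpha (v : TangentBundle I.cotangent (CotangentBundle I M)) :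
    (tulczyjewAlpha I v).covec = v.vec.2 ∘L ContinuousLinearMap.fst ℝ E E +
      v.proj.covec ∘L ContinuousLinearMap.snd ℝ E E := rfl

theorem contMDiff_tangentProj :
    ContMDiff I.cotangent.tangent I.tangent ∞ (tangentProj I M) :=
  (contMDiff_proj (n := ∞) _).contMDiff_tangentMap (by simp)

theorem tangentProj_mem_source {v₀ v : TangentBundle I.cotangent (CotangentBundle I M)}
    (hv : v ∈ (extChartAt I.cotangent.tangent v₀).source) :
    tangentProj I M v ∈ (extChartAt I.tangent (tangentProj I M v₀)).source :=
  TangentBundle.mem_extChartAt_source_iff.2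
    (CotangentBundle.mem_extChartAt_source_iff.1 (TangentBundle.mem_extChartAt_source_iff.1 hv))

variable [I.Boundaryless]

theorem vec_tangentProj (v : TangentBundle I.cotangent (CotangentBundle I M)) :
    (tangentProj I M v).vec = v.vec.1 := by
  change tderiv I.cotangent I (cotangentProj I (M := M)) v.proj v.vec = _
  rw [tderiv_totalSpace_proj]
  rfl

theorem proj_tulczyjewAlpha (v : TangentBundle I.cotangent (CotangentBundle I M)) :
    (tulczyjewAlpha I v).proj = tangentProj I M v :=
  TangentBundle.ext' rfl (vec_tangentProj v).symm

/-- All charts involved come from one chart of `M`, so Tπ is `(q, p, q̇, ṗ) ↦ (q, q̇)` around every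
point and not only at the centre. -/
theorem extChartAt_tangentProj {v₀ v : TangentBundle I.cotangent (CotangentBundle I M)}
    (hv : v ∈ (extChartAt I.cotangent.tangent v₀).source) :
    extChartAt I.tangent (tangentProj I M v₀) (tangentProj I M v) =
      ((extChartAt I.cotangent.tangent v₀ v).1.1, (extChartAt I.cotangent.tangent v₀ v).2.1) := by
  have h1 := TangentBundle.mem_extChartAt_source_iff.1 hv
  have h2 := CotangentBundle.mem_extChartAt_source_iff.1 h1
  have h := fst_comp_tderiv_extChartAt h1 h2
  rw [tderiv_totalSpace_proj] at h
  have h3 : extChartAt I.cotangent.tangent v₀ v = _ := TangentBundle.extChartAt_apply h1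
  have h4 : extChartAt I.tangent (tangentProj I M v₀) (tangentProj I M v) =
      (extChartAt I v₀.proj.proj v.proj.proj,
        tderiv I 𝓘(ℝ, E) (extChartAt I v₀.proj.proj) v.proj.proj (tangentProj I M v).vec) :=
    TangentBundle.extChartAt_apply (v₀ := tangentProj I M v₀) (v := tangentProj I M v) h2
  rw [h4, h3, vec_tangentProj]
  refine Prod.ext ?_ (DFunLike.congr_fun h v.vec).symm
  exact (extChartAt_totalSpace_fst h1).symm

theorem tderiv_extChartAt_comp_tderiv_tangentProj
    {v₀ v : TangentBundle I.cotangent (CotangentBundle I M)}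
    (hv : v ∈ (extChartAt I.cotangent.tangent v₀).source) :
    tderiv I.tangent 𝓘(ℝ, E × E) (extChartAt I.tangent (tangentProj I M v₀)) (tangentProj I M v) ∘L
      tderiv I.cotangent.tangent I.tangent (tangentProj I M) v =
    (ContinuousLinearMap.fst ℝ E (E →L[ℝ] ℝ)).prodMap (ContinuousLinearMap.fst ℝ E (E →L[ℝ] ℝ)) ∘L
      tderiv I.cotangent.tangent 𝓘(ℝ, (E × (E →L[ℝ] ℝ)) × (E × (E →L[ℝ] ℝ)))
        (extChartAt I.cotangent.tangent v₀) v := by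
  set L := (ContinuousLinearMap.fst ℝ E (E →L[ℝ] ℝ)).prodMap
    (ContinuousLinearMap.fst ℝ E (E →L[ℝ] ℝ)) with hL
  have h1 : MDifferentiableAt I.cotangent.tangent I.tangent (tangentProj I M) v :=
    contMDiff_tangentProj.contMDiffAt.mdifferentiableAt (by simp)
  have h2 : MDifferentiableAt I.tangent 𝓘(ℝ, E × E) (extChartAt I.tangent (tangentProj I M v₀))
      (tangentProj I M v) :=
    mdifferentiableAt_extChartAt (by
      rw [← extChartAt_source I.tangent]; exact tangentProj_mem_source hv)
  have h3 : MDifferentiableAt I.cotangent.tangent 𝓘(ℝ, (E × (E →L[ℝ] ℝ)) × (E × (E →L[ℝ] ℝ)))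
      (extChartAt I.cotangent.tangent v₀) v :=
    mdifferentiableAt_extChartAt (by rwa [← extChartAt_source I.cotangent.tangent])
  have h4 : MDifferentiableAt 𝓘(ℝ, (E × (E →L[ℝ] ℝ)) × (E × (E →L[ℝ] ℝ))) 𝓘(ℝ, E × E) L
      (extChartAt I.cotangent.tangent v₀ v) := L.differentiableAt.mdifferentiableAt
  have h5 := tderiv_comp v h4 h3
  rw [tderiv_eq_fderiv, L.fderiv] at h5
  rw [← h5, ← tderiv_comp v h2 h1]
  apply tderiv_congr
  filter_upwards [extChartAt_source_mem_nhds' hv] with w hw using extChartAt_tangentProj hw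

theorem tderiv_tangentProj (v : TangentBundle I.cotangent (CotangentBundle I M)) :
    tderiv I.cotangent.tangent I.tangent (tangentProj I M) v =
      (ContinuousLinearMap.fst ℝ E (E →L[ℝ] ℝ)).prodMap (ContinuousLinearMap.fst ℝ E (E →L[ℝ] ℝ)) := by
  have := tderiv_extChartAt_comp_tderiv_tangentProj (mem_extChartAt_source v)
  rwa [tderiv_extChartAt_self, tderiv_extChartAt_self] at this

/-- At each point, `d_T θ` is `X ↦ α(v) (T(Tπ) X)`. -/
theorem coef_dT_liouvilleForm_apply (v : TangentBundle I.cotangent (CotangentBundle I M))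
    (X : Fin 1 → (E × (E →L[ℝ] ℝ)) × (E × (E →L[ℝ] ℝ))) :
    DiffForm.coef (DiffForm.dT I.cotangent (liouvilleForm I M)) v X =
      (tulczyjewAlpha I v).covec (tderiv I.cotangent.tangent I.tangent (tangentProj I M) v (X 0)) := by
  have h : DiffForm.coef (DiffForm.dT I.cotangent (liouvilleForm I M)) v = DiffForm.coef
    (DiffForm.pullback _ _ (extChartAt I.cotangent.tangent v) (DiffForm.ofModel _)) v :=
    DiffForm.hasChartExpr_dT_liouvilleForm v v (mem_extChartAt_source v)
  have hid (u : E × (E →L[ℝ] ℝ)) : tderiv I.cotangent 𝓘(ℝ, E × (E →L[ℝ] ℝ))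
      (extChartAt I.cotangent v.proj) v.proj u = u := by
    rw [tderiv_extChartAt_self]; rfl
  have hid' : v.proj.covec ∘L tderiv 𝓘(ℝ, E) I (extChartAt I v.proj.proj).symm
      (extChartAt I v.proj.proj v.proj.proj) = v.proj.covec := by
    have := tderiv_extChartAt_symm_comp (I := I) (mem_extChartAt_source v.proj.proj)
    rw [tderiv_extChartAt_self] at this
    rw [← ContinuousLinearMap.comp_id (tderiv 𝓘(ℝ, E) I _ _), this]
    rfl
  rw [h, DiffForm.coef_pullback, tderiv_extChartAt_self, tderiv_tangentProj, DiffForm.coef_ofModel,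
    ContinuousAlternatingMap.compContinuousLinearMap_apply, linForm_apply, tangentBilin_apply,
    liouvilleBilin_apply, liouvilleBilin_apply,
    TangentBundle.extChartAt_apply (mem_extChartAt_source _), hid,
    CotangentBundle.extChartAt_apply (mem_extChartAt_source _), hid']
  rfl

/-- The definition uses a different chart at each base point, so smoothness is not evident. However,
d_T θ is `α(v) ∘ T(Tπ)` at every `v`, and it has linear coefficients in the fixed chart around `v₀`;
comparing the two shows that the covector has coordinates `(ṗ, p)` in that chart as well. -/
theorem contMDiff_tulczyjewAlpha :
    ContMDiff I.cotangent.tangent I.tangent.cotangent ∞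
      (tulczyjewAlpha I : TangentBundle I.cotangent (CotangentBundle I M) → _) := by
  intro v₀
  have hch : ContMDiffAt I.cotangent.tangent 𝓘(ℝ, (E × (E →L[ℝ] ℝ)) × (E × (E →L[ℝ] ℝ))) ∞
    (extChartAt I.cotangent.tangent v₀) v₀ := contMDiffAt_extChartAt
  refine CotangentBundle.contMDiffAt_of_coordinates (m := fun v =>
    (extChartAt I.cotangent.tangent v₀ v).2.2 ∘L ContinuousLinearMap.fst ℝ E E +
      (extChartAt I.cotangent.tangent v₀ v).1.2 ∘L ContinuousLinearMap.snd ℝ E E) ?_ ?_ ?_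
  · simp_rw [proj_tulczyjewAlpha]
    exact contMDiff_tangentProj v₀
  · refine ContMDiffAt.add (ContMDiffAt.clm_comp ?_ contMDiffAt_const)
      (ContMDiffAt.clm_comp ?_ contMDiffAt_const)
    · exact (contDiffAt_snd.comp _ contDiffAt_snd : ContDiffAt ℝ ∞ (fun z :
        (E × (E →L[ℝ] ℝ)) × (E × (E →L[ℝ] ℝ)) => z.2.2) _).contMDiffAt.comp v₀ hch
    · exact (contDiffAt_snd.comp _ contDiffAt_fst : ContDiffAt ℝ ∞ (fun z :
        (E × (E →L[ℝ] ℝ)) × (E × (E →L[ℝ] ℝ)) => z.1.2) _).contMDiffAt.comp v₀ hch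
  · filter_upwards [extChartAt_source_mem_nhds (I := I.cotangent.tangent) v₀] with v hv
    have hX (X : (E × (E →L[ℝ] ℝ)) × (E × (E →L[ℝ] ℝ))) :=
      coef_dT_liouvilleForm_apply v ![X]
    have h : DiffForm.coef (DiffForm.dT I.cotangent (liouvilleForm I M)) v = DiffForm.coef
      (DiffForm.pullback _ _ (extChartAt I.cotangent.tangent v₀) (DiffForm.ofModel _)) v :=
      DiffForm.hasChartExpr_dT_liouvilleForm v₀ v hv
    rw [h] at hX
    have hL := tderiv_extChartAt_comp_tderiv_tangentProj hv
    rw [tderiv_tangentProj] at hL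
    rw [proj_tulczyjewAlpha, proj_tulczyjewAlpha]
    refine ContinuousLinearMap.ext fun Y => ?_
    -- A lift of `Y` through T(Tπ), with zero momentum components.
    have hY := hX ((Y.1, 0), (Y.2, 0))
    have hLY := DFunLike.congr_fun hL ((Y.1, 0), (Y.2, 0))
    rw [DiffForm.coef_pullback, DiffForm.coef_ofModel,
      ContinuousAlternatingMap.compContinuousLinearMap_apply, linForm_apply, tangentBilin_apply,
      liouvilleBilin_apply, liouvilleBilin_apply, tderiv_tangentProj] at hY
    refine Eq.trans ?_ hY
    exact congrArg₂ (· + ·)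
      (congrArg (extChartAt I.cotangent.tangent v₀ v).2.2 (congrArg Prod.fst hLY))
      (congrArg (extChartAt I.cotangent.tangent v₀ v).1.2 (congrArg Prod.snd hLY))

/-- `α_M^* θ_{TM} = d_T θ_M`. -/
theorem pullback_tulczyjewAlpha_liouvilleForm
    (v : TangentBundle I.cotangent (CotangentBundle I M)) :
    DiffForm.pullback I.cotangent.tangent I.tangent.cotangent (tulczyjewAlpha I)
      (liouvilleForm I.tangent (TangentBundle I M)) v =
      DiffForm.dT I.cotangent (liouvilleForm I M) v := by
  have hp : MDifferentiableAt I.tangent.cotangent I.tangent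
      (cotangentProj I.tangent (M := TangentBundle I M)) (tulczyjewAlpha I v) :=
    (contMDiffAt_proj _ (n := 1)).mdifferentiableAt (by simp)
  have h := tderiv_comp v hp (contMDiff_tulczyjewAlpha.contMDiffAt.mdifferentiableAt (by simp))
  -- Since π_{TM} ∘ α_M = Tπ, the pulled-back Liouville form is `X ↦ α(v) (T(Tπ) X)`, which is d_T
  -- θ.
  have h' : cotangentProj I.tangent (M := TangentBundle I M) ∘ tulczyjewAlpha I = tangentProj I M :=
    funext proj_tulczyjewAlpha
  rw [h', tderiv_totalSpace_proj] at h
  apply DiffForm.coef_ext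
  ext X
  rw [coef_dT_liouvilleForm_apply, h, DiffForm.coef_pullback,
    ContinuousAlternatingMap.compContinuousLinearMap_apply, DiffForm.coef_liouvilleForm_apply]
  rfl

end Tulczyjew

/-! ### Inverse function theorem and diffeomorphisms onto open images -/

section InverseFunction

variable {E : Type*} [NormedAddCommGroup E] [NormedSpace ℝ E]
  {H : Type*} [TopologicalSpace H] {I : ModelWithCorners ℝ E H}
  {E' : Type*} [NormedAddCommGroup E'] [NormedSpace ℝ E']
  {H' : Type*} [TopologicalSpace H'] {J : ModelWithCorners ℝ E' H'}
  {N : Type*} [TopologicalSpace N] [ChartedSpace H' N]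
  {M : Type*} [TopologicalSpace M] [ChartedSpace H M]

/-- The inverse function theorem on boundaryless manifolds. -/
theorem ContMDiffAt.exists_local_inverse [I.Boundaryless] [J.Boundaryless] [IsManifold I ∞ M]
    [IsManifold J ∞ N] [CompleteSpace E] {f : M → N} {x₀ : M} (hf : ContMDiffAt I J ∞ f x₀)
    (hinv : (tderiv I J f x₀).IsInvertible) :
    ∃ g : N → M, ContMDiffAt J I ∞ g (f x₀) ∧ g (f x₀) = x₀ ∧
      (∀ᶠ y in 𝓝 (f x₀), f (g y) = y) ∧ ∀ᶠ x in 𝓝 x₀, g (f x) = x := by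
  set φ := extChartAt I x₀ with hφ
  set ψ := extChartAt J (f x₀) with hψ
  set F := writtenInExtChartAt I J x₀ f with hF
  have hc : ContDiffAt ℝ ∞ F (φ x₀) := by
    have := (contMDiffAt_iff.1 hf).2
    rw [I.range_eq_univ] at this
    exact this.contDiffAt Filter.univ_mem
  obtain ⟨e, he⟩ := hinv
  have hd : HasFDerivAt F (e : E →L[ℝ] E') (φ x₀) := by
    rw [he, tderiv_eq_fderiv_writtenInExtChartAt (hf.mdifferentiableAt (by simp))]
    exact (hc.differentiableAt (by simp)).hasFDerivAt
  have hFx : F (φ x₀) = ψ (f x₀) := by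
    simp [hF, writtenInExtChartAt, hφ, hψ]
  set h := hc.localInverse hd (by simp) with hh
  have hhs : ContDiffAt ℝ ∞ h (ψ (f x₀)) := hFx ▸ hc.to_localInverse hd (by simp)
  have hhx : h (ψ (f x₀)) = φ x₀ := by
    rw [← hFx]; exact hc.localInverse_apply_image hd (by simp)
  have hstrict := hc.hasStrictFDerivAt' hd (by simp)
  have hr : ∀ᶠ z in 𝓝 (ψ (f x₀)), F (h z) = z := hFx ▸ hstrict.eventually_right_inverse
  have hl : ∀ᶠ z in 𝓝 (φ x₀), h (F z) = z := hstrict.eventually_left_inverse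
  have hψs : ContMDiffAt J 𝓘(ℝ, E') ∞ ψ (f x₀) := contMDiffAt_extChartAt
  have hφs : ContMDiffAt 𝓘(ℝ, E) I ∞ φ.symm (φ x₀) :=
    (contMDiffOn_extChartAt_symm x₀).contMDiffAt (extChartAt_target_mem_nhds x₀)
  have hg : ContMDiffAt J I ∞ (φ.symm ∘ h ∘ ψ) (f x₀) := by
    refine ContMDiffAt.comp _ ?_ (hhs.contMDiffAt.comp _ hψs)
    rw [Function.comp_apply, hhx]
    exact hφs
  have hgx : (φ.symm ∘ h ∘ ψ) (f x₀) = x₀ := by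
    simp only [Function.comp_apply, hhx]
    exact extChartAt_to_inv x₀
  refine ⟨φ.symm ∘ h ∘ ψ, hg, hgx, ?_, ?_⟩
  · have e1 : ∀ᶠ y in 𝓝 (f x₀), F (h (ψ y)) = ψ y := hψs.continuousAt.eventually hr
    have e2 : ∀ᶠ y in 𝓝 (f x₀), f ((φ.symm ∘ h ∘ ψ) y) ∈ ψ.source := by
      have : ContinuousAt (f ∘ (φ.symm ∘ h ∘ ψ)) (f x₀) :=
        ContinuousAt.comp (by rw [hgx]; exact hf.continuousAt) hg.continuousAt
      refine this.preimage_mem_nhds ?_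
      rw [Function.comp_apply, hgx]
      exact extChartAt_source_mem_nhds _
    have e3 : ∀ᶠ y in 𝓝 (f x₀), y ∈ ψ.source := extChartAt_source_mem_nhds _
    filter_upwards [e1, e2, e3] with y h1 h2 h3
    exact ψ.injOn h2 h3 h1
  · have e1 : ∀ᶠ x in 𝓝 x₀, h (F (φ x)) = φ x :=
      (continuousAt_extChartAt (I := I) x₀).eventually hl
    have e2 : ∀ᶠ x in 𝓝 x₀, x ∈ φ.source := extChartAt_source_mem_nhds _
    filter_upwards [e1, e2] with x h1 h2
    have h3 : F (φ x) = ψ (f x) := by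
      change ψ (f (φ.symm (φ x))) = _
      rw [φ.left_inv h2]
    rw [h3] at h1
    simp only [Function.comp_apply, h1, φ.left_inv h2]

/-- An injective smooth map with invertible derivatives is a diffeomorphism onto an open set. -/
theorem isDiffeoOn_image_of_injOn [I.Boundaryless] [J.Boundaryless] [IsManifold I ∞ M]
    [IsManifold J ∞ N] [CompleteSpace E] {f : M → N} {A : Set M} (hA : IsOpen A)
    (hf : ContMDiffOn I J ∞ f A) (hinj : InjOn f A)
    (hd : ∀ x ∈ A, (tderiv I J f x).IsInvertible) (g₀ : N → M) :
    IsDiffeoOn I J f A (f '' A) := by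
  classical
  have key (x : M) (hx : x ∈ A) : ∃ g : N → M, ContMDiffAt J I ∞ g (f x) ∧
      ∀ᶠ y in 𝓝 (f x), g y ∈ A ∧ f (g y) = y := by
    obtain ⟨g, h1, h2, h3, -⟩ :=
      (hf.contMDiffAt (hA.mem_nhds hx)).exists_local_inverse (hd x hx)
    refine ⟨g, h1, ?_⟩
    have : ∀ᶠ y in 𝓝 (f x), g y ∈ A :=
      h1.continuousAt.preimage_mem_nhds (by rw [h2]; exact hA.mem_nhds hx)
    exact this.and h3
  -- The set-theoretic inverse on the image; `g₀` merely supplies values elsewhere. Near each image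
  -- point it agrees with a smooth local inverse, by injectivity.
  let g : N → M := fun y => if h : y ∈ f '' A then h.choose else g₀ y
  have hg (x : M) (hx : x ∈ A) : g (f x) = x := by
    have h : f x ∈ f '' A := mem_image_of_mem f hx
    simp only [g, dif_pos h]
    exact hinj h.choose_spec.1 hx h.choose_spec.2
  refine ⟨hA, ?_, hinj.bijOn_image, hf, g, hg, ?_⟩
  · rw [isOpen_iff_mem_nhds]
    rintro _ ⟨x, hx, rfl⟩
    obtain ⟨g', -, h⟩ := key x hx
    filter_upwards [h] with y hy using ⟨g' y, hy.1, hy.2⟩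
  · rintro _ ⟨x, hx, rfl⟩
    obtain ⟨g', h1, h⟩ := key x hx
    refine (h1.congr_of_eventuallyEq ?_).contMDiffWithinAt
    filter_upwards [h] with y hy
    rw [← hg (g' y) hy.1, hy.2]

/-- As both sets are open, `g ∘ f = id` and `f ∘ g = id` hold on neighbourhoods and can be
differentiated. -/
theorem IsDiffeoOn.isInvertible_tderiv {f : M → N} {A : Set M} {B : Set N}
    (h : IsDiffeoOn I J f A B) {x : M} (hx : x ∈ A) : (tderiv I J f x).IsInvertible := by
  obtain ⟨hA, hB, hbij, hf, g, hg, hgs⟩ := h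
  have hy : f x ∈ B := hbij.mapsTo hx
  have hfx : MDifferentiableAt I J f x :=
    (hf.contMDiffAt (hA.mem_nhds hx)).mdifferentiableAt (by simp)
  have hgx : MDifferentiableAt J I g (f x) :=
    (hgs.contMDiffAt (hB.mem_nhds hy)).mdifferentiableAt (by simp)
  refine .of_inverse (g := tderiv J I g (f x)) ?_ ?_
  · rw [← tderiv_comp_of_eq hfx hgx (hg hx), ← tderiv_id (I := J) (f x)]
    apply tderiv_congr
    filter_upwards [hB.mem_nhds hy] with y hy
    obtain ⟨z, hz, rfl⟩ := hbij.surjOn hy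
    simp [hg hz]
  · rw [← tderiv_comp x hgx hfx, ← tderiv_id (I := I) x]
    apply tderiv_congr
    filter_upwards [hA.mem_nhds hx] with z hz using hg hz

end InverseFunction

/-! ### The cotangent lift is a symplectomorphism -/

section Lift

variable {E : Type*} [NormedAddCommGroup E] [NormedSpace ℝ E]
  {H : Type*} [TopologicalSpace H] {I : ModelWithCorners ℝ E H}
  {Q : Type*} [TopologicalSpace Q] [ChartedSpace H Q] [IsManifold I ∞ Q]

theorem exists_tulczyjewAlpha_eq (α : CotangentBundle I.tangent (TangentBundle I Q)) :
    ∃ v : TangentBundle I.cotangent (CotangentBundle I Q), tulczyjewAlpha I v = α := by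
  -- The `δv` part of the covector becomes the momentum `p`, the `δq` part becomes `ṗ`.
  refine ⟨⟨⟨α.proj.proj, α.covec ∘L ContinuousLinearMap.inr ℝ E E⟩,
    (α.proj.vec, α.covec ∘L ContinuousLinearMap.inl ℝ E E)⟩, CotangentBundle.ext' rfl ?_⟩
  rw [covec_tulczyjewAlpha]
  change (α.covec ∘L ContinuousLinearMap.inl ℝ E E) ∘L ContinuousLinearMap.fst ℝ E E +
    (α.covec ∘L ContinuousLinearMap.inr ℝ E E) ∘L ContinuousLinearMap.snd ℝ E E = α.covec
  ext u <;> simp <;> exact map_zero α.covec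

variable [I.Boundaryless]

theorem proj_cotangentLift (R : TangentBundle I Q → Q × Q)
    (v : TangentBundle I.cotangent (CotangentBundle I Q)) :
    Prod.map (cotangentProj I) (cotangentProj I) (cotangentLift I R v) = R (tangentProj I Q v) := by
  rw [← proj_tulczyjewAlpha]
  rfl

theorem tulczyjewAlpha_injective :
    Function.Injective (tulczyjewAlpha I :
      TangentBundle I.cotangent (CotangentBundle I Q) → _) := by
  intro v w h
  have h1 : tangentProj I Q v = tangentProj I Q w := by
    rw [← proj_tulczyjewAlpha, ← proj_tulczyjewAlpha, h]
  have h2 : (tulczyjewAlpha I v).covec = (tulczyjewAlpha I w).covec := by rw [h]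
  have h3 : v.vec.1 = w.vec.1 := by rw [← vec_tangentProj, ← vec_tangentProj, h1]
  have h4 : v.proj.proj = w.proj.proj := congrArg (fun ξ : TangentBundle I Q => ξ.proj) h1
  rw [covec_tulczyjewAlpha, covec_tulczyjewAlpha] at h2
  refine TangentBundle.ext' (CotangentBundle.ext' h4 ?_) (Prod.ext h3 ?_)
  · ext u
    simpa using DFunLike.congr_fun h2 (0, u)
  · ext u
    simpa using DFunLike.congr_fun h2 (u, 0)

/-- Φ and α_Q are bijections; over `V`, `\hat R` covers the injective map `R` and acts on each fibre
by composition with an invertible operator. -/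
theorem bijOn_cotangentLift {R : TangentBundle I Q → Q × Q} {V : Set (TangentBundle I Q)}
    (hinj : InjOn R V) (hinv : ∀ ξ ∈ V, (tderiv I.tangent (I.prod I) R ξ).IsInvertible) :
    BijOn (cotangentLift I R) (tangentProj I Q ⁻¹' V)
      (Prod.map (cotangentProj I) (cotangentProj I) ⁻¹' (R '' V)) := by
  refine ⟨fun v hv => ?_, fun v hv w hw h => ?_, fun b hb => ?_⟩
  · rw [mem_preimage, proj_cotangentLift]
    exact mem_image_of_mem R hv
  · have h1 : cotangentHat I.tangent (I.prod I) R (tulczyjewAlpha I v) =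
        cotangentHat I.tangent (I.prod I) R (tulczyjewAlpha I w) :=
      (cotangentPhi I).symm.injective h
    have h2 : (tulczyjewAlpha I v).proj = (tulczyjewAlpha I w).proj := by
      refine hinj ?_ ?_ (congrArg TotalSpace.proj h1)
      · rwa [proj_tulczyjewAlpha]
      · rwa [proj_tulczyjewAlpha]
    refine tulczyjewAlpha_injective (CotangentBundle.ext' h2 ?_)
    have h3 := congrArg CotangentBundle.covec h1
    rw [covec_cotangentHat, covec_cotangentHat, h2] at h3
    have hi := hinv _ hw
    rw [← proj_tulczyjewAlpha] at hi
    refine ContinuousLinearMap.ext fun u => ?_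
    simpa [hi.inverse_apply_self] using
      DFunLike.congr_fun h3 (tderiv I.tangent (I.prod I) R (tulczyjewAlpha I w).proj u)
  · obtain ⟨ξ, hξ, hξb⟩ := hb
    -- The preimage: pull the covector Φ(b) back along `T R` and undo α_Q.
    obtain ⟨v, hv⟩ := exists_tulczyjewAlpha_eq (I := I) (Q := Q)
      ⟨ξ, (cotangentPhi I b).covec ∘L tderiv I.tangent (I.prod I) R ξ⟩
    have hvξ : tangentProj I Q v = ξ := by rw [← proj_tulczyjewAlpha, hv]
    refine ⟨v, by rwa [mem_preimage, hvξ], ?_⟩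
    change (cotangentPhi I).symm (cotangentHat I.tangent (I.prod I) R (tulczyjewAlpha I v)) = b
    rw [Equiv.symm_apply_eq, hv]
    refine CotangentBundle.ext' hξb ?_
    rw [covec_cotangentHat]
    refine ContinuousLinearMap.ext fun u => ?_
    exact congrArg (cotangentPhi I b).covec ((hinv ξ hξ).self_apply_inverse u)

variable [CompleteSpace E]

theorem contMDiffAt_cotangentLift {R : TangentBundle I Q → Q × Q}
    {v : TangentBundle I.cotangent (CotangentBundle I Q)}
    (hR : ContMDiffAt I.tangent (I.prod I) ∞ R (tangentProj I Q v))
    (hinv : (tderiv I.tangent (I.prod I) R (tangentProj I Q v)).IsInvertible) :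
    ContMDiffAt I.cotangent.tangent (I.cotangent.prod I.cotangent) ∞ (cotangentLift I R) v := by
  rw [← proj_tulczyjewAlpha] at hR hinv
  exact contMDiff_cotangentPhi_symm.contMDiffAt.comp v
    ((contMDiffAt_cotangentHat hR hinv).comp v contMDiff_tulczyjewAlpha.contMDiffAt)

/-- The three factors carry θ₁₂ to θ_{Q×Q}, then to θ_{TQ}, then to d_T θ_Q. -/
theorem pullback_cotangentLift_theta12 {R : TangentBundle I Q → Q × Q}
    {v : TangentBundle I.cotangent (CotangentBundle I Q)}
    (hR : ContMDiffAt I.tangent (I.prod I) ∞ R (tangentProj I Q v))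
    (hinv : (tderiv I.tangent (I.prod I) R (tangentProj I Q v)).IsInvertible) :
    DiffForm.pullback I.cotangent.tangent (I.cotangent.prod I.cotangent) (cotangentLift I R)
      (theta12 I Q) v = DiffForm.dT I.cotangent (liouvilleForm I Q) v := by
  rw [← proj_tulczyjewAlpha] at hR hinv
  have ha : MDifferentiableAt I.cotangent.tangent I.tangent.cotangent (tulczyjewAlpha I) v :=
    contMDiff_tulczyjewAlpha.contMDiffAt.mdifferentiableAt (by simp)
  have hh := (contMDiffAt_cotangentHat hR hinv).mdifferentiableAt (by simp)
  have hp := (contMDiff_cotangentPhi_symm (I := I) (M := Q)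
    (cotangentHat I.tangent (I.prod I) R (tulczyjewAlpha I v))).mdifferentiableAt (by simp)
  unfold cotangentLift
  rw [DiffForm.pullback_comp (f := cotangentHat I.tangent (I.prod I) R ∘ tulczyjewAlpha I)
    (g := (cotangentPhi I).symm) hp (hh.comp v ha)]
  rw [funext (pullback_cotangentPhi_symm_theta12 (I := I) (M := Q)), DiffForm.pullback_comp hh ha,
    ← pullback_tulczyjewAlpha_liouvilleForm]
  apply DiffForm.coef_ext
  rw [DiffForm.coef_pullback, DiffForm.coef_pullback]
  congr 1
  exact pullback_cotangentHat_liouvilleForm hR hinv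

theorem pullback_cotangentLift_omega12 {R : TangentBundle I Q → Q × Q} {V : Set (TangentBundle I Q)}
    (hV : IsOpen V) (hR : ContMDiffOn I.tangent (I.prod I) ∞ R V)
    (hinv : ∀ ξ ∈ V, (tderiv I.tangent (I.prod I) R ξ).IsInvertible)
    {v : TangentBundle I.cotangent (CotangentBundle I Q)} (hv : tangentProj I Q v ∈ V) :
    DiffForm.pullback I.cotangent.tangent (I.cotangent.prod I.cotangent) (cotangentLift I R)
      (omega12 I Q) v = DiffForm.dT I.cotangent (canonicalForm I Q) v := by
  have hs := contMDiffAt_cotangentLift (hR.contMDiffAt (hV.mem_nhds hv)) (hinv _ hv)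
  have hθ : DifferentiableAt ℝ (DiffForm.inChart (I.cotangent.prod I.cotangent) (theta12 I Q)
      (cotangentLift I R v)) (extChartAt (I.cotangent.prod I.cotangent) (cotangentLift I R v)
        (cotangentLift I R v)) := by
    refine (differentiable_linForm _ _).congr_of_eventuallyEq
      (Filter.eventuallyEq_of_mem (extChartAt_target_mem_nhds _)
        (DiffForm.hasChartExpr_theta12 (cotangentLift I R v)).inChart_eqOn)
  have h1 := DiffForm.d_pullback hs hθ
  have h2 : DiffForm.d I.cotangent.tangent (DiffForm.pullback I.cotangent.tangent
      (I.cotangent.prod I.cotangent) (cotangentLift I R) (theta12 I Q)) v =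
      DiffForm.d I.cotangent.tangent (DiffForm.dT I.cotangent (liouvilleForm I Q)) v := by
    -- Equality at the single point `v` would not suffice: `d` needs it on a neighbourhood, which
    -- the open preimage of `V` provides.
    apply DiffForm.d_congr
    have : ∀ᶠ w in 𝓝 v, tangentProj I Q w ∈ V :=
      contMDiff_tangentProj.continuous.continuousAt.preimage_mem_nhds (hV.mem_nhds hv)
    filter_upwards [this] with w hw
    exact pullback_cotangentLift_theta12 (hR.contMDiffAt (hV.mem_nhds hw)) (hinv _ hw)
  rw [DiffForm.dT_canonicalForm_eq, ← h2, h1]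
  apply DiffForm.coef_ext
  have h3 := DiffForm.omega12_eq (cotangentLift I R v)
  have h4 : DiffForm.coef (omega12 I Q) (cotangentLift I R v) = -DiffForm.coef
    (DiffForm.d (I.cotangent.prod I.cotangent) (theta12 I Q)) (cotangentLift I R v) := h3
  rw [DiffForm.coef_pullback, h4]
  rfl

/-- The cotangent lift of a diffeomorphism is a symplectomorphism. -/
theorem isSymplectoOn_cotangentLift [FiniteDimensional ℝ E] {R : TangentBundle I Q → Q × Q}
    {V : Set (TangentBundle I Q)} (h : IsDiffeoOn I.tangent (I.prod I) R V (R '' V)) :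
    IsSymplectoOn I.cotangent.tangent (I.cotangent.prod I.cotangent)
      (DiffForm.dT I.cotangent (canonicalForm I Q)) (omega12 I Q) (cotangentLift I R)
      (tangentProj I Q ⁻¹' V) (Prod.map (cotangentProj I) (cotangentProj I) ⁻¹' (R '' V)) := by
  have hinv : ∀ ξ ∈ V, (tderiv I.tangent (I.prod I) R ξ).IsInvertible :=
    fun ξ hξ => h.isInvertible_tderiv hξ
  obtain ⟨hV, hRV, hbij, hR, -⟩ := h
  have hb := bijOn_cotangentLift hbij.injOn hinv
  have hω (v) (hv : v ∈ tangentProj I Q ⁻¹' V) := pullback_cotangentLift_omega12 hV hR hinv hv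
  refine ⟨?_, hω⟩
  rw [← hb.image_eq]
  refine isDiffeoOn_image_of_injOn (hV.preimage contMDiff_tangentProj.continuous)
    (fun v hv => (contMDiffAt_cotangentLift (hR.contMDiffAt (hV.mem_nhds hv))
      (hinv _ hv)).contMDiffWithinAt) hb.injOn (fun v hv => ?_) (fun a => ⟨a.1, 0⟩)
  set T := tderiv I.cotangent.tangent (I.cotangent.prod I.cotangent) (cotangentLift I R) v with hT
  -- A vector killed by the derivative lies in the kernel of the pulled-back form d_T ω, which is
  -- nondegenerate.
  have hker : ∀ X, T X = 0 → X = 0 := by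
    intro X hX
    refine DiffForm.isSymplectic_dT_canonicalForm.nondegenerate v X fun w => ?_
    rw [← hω v hv]
    change DiffForm.coef (omega12 I Q) (cotangentLift I R v) (fun i => T (![X, w] i)) = 0
    refine ContinuousAlternatingMap.map_coord_zero _ 0 ?_
    exact hX
  have hTi : Function.Injective T := (injective_iff_map_eq_zero T).2 hker
  -- Source and target share the model space `(E × E^*) × (E × E^*)`, of finite dimension, so
  -- injectivity suffices.
  exact ⟨(LinearEquiv.ofInjectiveEndo (T : _ →ₗ[ℝ] _) hTi).toContinuousLinearEquiv,
    ContinuousLinearMap.ext fun _ => rfl⟩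

end Lift

/-! ### From local injectivity to injectivity near a section -/

/-- A map which is injective near each point of a section `z` of `p ∘ f` is injective on a
neighbourhood of the image of `z`. -/
theorem exists_isOpen_injOn_of_section {X Y B : Type*} [TopologicalSpace X] [TopologicalSpace B]
    [TopologicalSpace.MetrizableSpace X] {f : X → Y} {p : Y → B} {z : B → X}
    (hz : Continuous z) (hpz : ∀ b, p (f (z b)) = b) (hpf : ∀ b, ContinuousAt (p ∘ f) (z b))
    (hloc : ∀ b, ∃ u ∈ 𝓝 (z b), InjOn f u) :
    ∃ V : Set X, IsOpen V ∧ (∀ b, z b ∈ V) ∧ InjOn f V := by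
  let := TopologicalSpace.metrizableSpaceMetric X
  -- Points lying in a ball of injectivity centred at their own base point `z (p (f ξ))`. If `f ξ =
  -- f η` the centres coincide, so the larger of the two balls contains both points.
  let W : Set X := {ξ | ∃ r, dist ξ (z (p (f ξ))) < r ∧ InjOn f (Metric.ball (z (p (f ξ))) r)}
  refine ⟨interior W, isOpen_interior, fun b => ?_, InjOn.mono interior_subset ?_⟩
  · obtain ⟨u, hu, hfu⟩ := hloc b
    obtain ⟨r, hr, hru⟩ := Metric.mem_nhds_iff.1 hu
    rw [mem_interior_iff_mem_nhds]
    -- With `r / 4` twice, `ξ` is within `r / 2` of its own centre, and the ball of radius `r / 2`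
    -- about that centre stays inside the ball of radius `r` about `z b`.
    have h1 : ∀ᶠ ξ in 𝓝 (z b), dist ξ (z b) < r / 4 := Metric.ball_mem_nhds _ (by positivity)
    have h2 : ∀ᶠ ξ in 𝓝 (z b), dist (z (p (f ξ))) (z b) < r / 4 := by
      have : ContinuousAt (z ∘ (p ∘ f)) (z b) := hz.continuousAt.comp (hpf b)
      refine this.preimage_mem_nhds (t := Metric.ball (z b) (r / 4)) ?_
      rw [Function.comp_apply, Function.comp_apply, hpz]
      exact Metric.ball_mem_nhds _ (by positivity)
    filter_upwards [h1, h2] with ξ h1 h2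
    refine ⟨r / 2, ?_, hfu.mono (Subset.trans (fun η hη => ?_) hru)⟩
    · have := dist_triangle_right ξ (z (p (f ξ))) (z b)
      linarith
    · have := dist_triangle η (z (p (f ξ))) (z b)
      rw [Metric.mem_ball] at hη ⊢
      linarith
  · rintro ξ ⟨r, hr, hfr⟩ η ⟨s, hs, hfs⟩ h
    rw [← h] at hs hfs
    rcases le_total r s with hrs | hrs
    · exact hfs (hr.trans_le hrs) hs h
    · exact hfr hr (hs.trans_le hrs) h

/-! ### Local diffeomorphisms near a point with invertible derivative -/

section EventuallyInvertible

variable {E : Type*} [NormedAddCommGroup E] [NormedSpace ℝ E]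
  {H : Type*} [TopologicalSpace H] {I : ModelWithCorners ℝ E H}
  {M : Type*} [TopologicalSpace M] [ChartedSpace H M] [IsManifold I ∞ M]
  {E' : Type*} [NormedAddCommGroup E'] [NormedSpace ℝ E']
  {H' : Type*} [TopologicalSpace H'] {J : ModelWithCorners ℝ E' H'}
  {N : Type*} [TopologicalSpace N] [ChartedSpace H' N] [IsManifold J ∞ N]

theorem ContMDiffAt.eventually_mdifferentiableAt {f : M → N} {x₀ : M}
    (hf : ContMDiffAt I J ∞ f x₀) : ∀ᶠ x in 𝓝 x₀, MDifferentiableAt I J f x := by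
  have : ContMDiffAt I J 1 f x₀ := hf.of_le (by simp)
  have h := (contMDiffAt_iff_contMDiffAt_nhds (by simp)).1 this
  filter_upwards [h] with x hx using hx.mdifferentiableAt (by simp)

variable [I.Boundaryless] [J.Boundaryless] [CompleteSpace E]

theorem ContMDiffAt.exists_mem_nhds_injOn {f : M → N} {x₀ : M} (hf : ContMDiffAt I J ∞ f x₀)
    (hinv : (tderiv I J f x₀).IsInvertible) : ∃ u ∈ 𝓝 x₀, InjOn f u := by
  obtain ⟨g, -, -, -, hl⟩ := hf.exists_local_inverse hinv
  exact ⟨_, hl, LeftInvOn.injOn fun _ h => h⟩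

/-- The identities satisfied by a local inverse hold on open sets and can be differentiated at every
nearby point. -/
theorem ContMDiffAt.eventually_isInvertible_tderiv {f : M → N} {x₀ : M}
    (hf : ContMDiffAt I J ∞ f x₀) (hinv : (tderiv I J f x₀).IsInvertible) :
    ∀ᶠ x in 𝓝 x₀, (tderiv I J f x).IsInvertible := by
  obtain ⟨g, hg, hgx, hr, hl⟩ := hf.exists_local_inverse hinv
  have hc := hf.continuousAt
  filter_upwards [hl.eventually_nhds, hc.eventually hr.eventually_nhds,
    hf.eventually_mdifferentiableAt, hc.eventually hg.eventually_mdifferentiableAt]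
    with x h1 h2 h3 h4
  refine .of_inverse (g := tderiv J I g (f x)) ?_ ?_
  · rw [← tderiv_comp_of_eq h3 h4 h1.self_of_nhds, ← tderiv_id (I := J) (f x)]
    exact tderiv_congr h2
  · rw [← tderiv_comp x h4 h3, ← tderiv_id (I := I) x]
    exact tderiv_congr h1

end EventuallyInvertible

/-! ### Topology of TM, its zero section and its fibres -/

namespace TangentBundle

variable {E : Type*} [NormedAddCommGroup E] [NormedSpace ℝ E]
  {H : Type*} [TopologicalSpace H] {I : ModelWithCorners ℝ E H}
  {M : Type*} [TopologicalSpace M] [ChartedSpace H M] [IsManifold I ∞ M]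

/-- Vectors over one point lie in a common chart; vectors over different points are separated by the
projection. -/
theorem t2Space [T2Space M] : T2Space (TangentBundle I M) := by
  refine ⟨fun ξ η hne => ?_⟩
  by_cases h : ξ.proj = η.proj
  · set φ := extChartAt I.tangent ξ
    have hξ : ξ ∈ φ.source := mem_extChartAt_source ξ
    have hη : η ∈ φ.source := by
      rw [mem_extChartAt_source_iff, ← h]
      exact _root_.mem_extChartAt_source _
    obtain ⟨u, v, hu, hv, hξu, hηv, huv⟩ := t2_separation (φ.injOn.ne hξ hη hne)
    have hc := continuousOn_extChartAt (I := I.tangent) ξ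
    have ho : IsOpen φ.source := isOpen_extChartAt_source ξ
    exact ⟨_, _, hc.isOpen_inter_preimage ho hu, hc.isOpen_inter_preimage ho hv, ⟨hξ, hξu⟩,
      ⟨hη, hηv⟩, (huv.preimage φ).mono inter_subset_right inter_subset_right⟩
  · exact separated_by_continuous (FiberBundle.continuous_proj E (TangentSpace I)) h

theorem secondCountableTopology [SecondCountableTopology M] [FiniteDimensional ℝ E] :
    SecondCountableTopology (TangentBundle I M) := by
  obtain ⟨s, hs, hsM⟩ := TopologicalSpace.countable_cover_nhds (chart_source_mem_nhds H (M := M))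
  have := I.secondCountableTopology
  have : SecondCountableTopology (ModelProd H E) :=
    inferInstanceAs (SecondCountableTopology (H × E))
  refine ChartedSpace.secondCountable_of_countable_cover (ModelProd H E)
    (s := (fun x => (⟨x, 0⟩ : TangentBundle I M)) '' s) ?_ (hs.image _)
  refine eq_univ_of_forall fun ξ => ?_
  have := hsM.ge (mem_univ ξ.proj)
  simp only [mem_iUnion] at this ⊢
  obtain ⟨x, hx, hξ⟩ := this
  exact ⟨_, mem_image_of_mem _ hx, (mem_chart_source_iff _ _).2 hξ⟩

/-- Provides the metric needed to glue the local injectivity neighbourhoods along the zero section.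
-/
theorem metrizableSpace [T2Space M] [SecondCountableTopology M] [FiniteDimensional ℝ E] :
    TopologicalSpace.MetrizableSpace (TangentBundle I M) := by
  have := t2Space (I := I) (M := M)
  have := secondCountableTopology (I := I) (M := M)
  have := I.tangent.locallyCompactSpace
  have := ChartedSpace.locallyCompactSpace (ModelProd H E) (TangentBundle I M)
  exact Manifold.metrizableSpace I.tangent _

theorem tderiv_zeroSection (x : M) (u : E) :
    tderiv I I.tangent (zeroSection E (TangentSpace I : M → Type _)) x u = (u, 0) := by
  have h := tangentMap_tangentBundle_pure (I := I) (M := M) ⟨x, u⟩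
  exact eq_of_heq (TotalSpace.mk.inj h).2

theorem extChartAt_symm_fiber (x : M) (v : E) :
    (extChartAt I.tangent (⟨x, 0⟩ : TangentBundle I M)).symm (extChartAt I x x, v) = ⟨x, v⟩ := by
  have hs : (⟨x, v⟩ : TangentBundle I M) ∈
      (extChartAt I.tangent (⟨x, 0⟩ : TangentBundle I M)).source :=
    mem_extChartAt_source_iff.2 (_root_.mem_extChartAt_source (I := I) x)
  have h : extChartAt I.tangent (⟨x, 0⟩ : TangentBundle I M) ⟨x, v⟩ = (extChartAt I x x, v) := by
    refine (extChartAt_apply (v₀ := (⟨x, 0⟩ : TangentBundle I M))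
      (v := (⟨x, v⟩ : TangentBundle I M)) (_root_.mem_extChartAt_source (I := I) x)).trans ?_
    change (extChartAt I x x, tderiv I 𝓘(ℝ, E) (extChartAt I x) x v) = _
    rw [tderiv_extChartAt_self, ContinuousLinearMap.id_apply]
  rw [← h, PartialEquiv.left_inv _ hs]

variable [I.Boundaryless]

/-- In the chart around `0_x` the inclusion of the fibre is `v ↦ (x, v)`, and the chart derivative
at `0_x` is the identity. -/
theorem mdifferentiableAt_and_tderiv_fiber (x : M) :
    MDifferentiableAt 𝓘(ℝ, E) I.tangent (fun v : E => (⟨x, v⟩ : TangentBundle I M)) 0 ∧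
    tderiv 𝓘(ℝ, E) I.tangent (fun v : E => (⟨x, v⟩ : TangentBundle I M)) 0 =
      ContinuousLinearMap.inr ℝ E E := by
  set ξ : TangentBundle I M := ⟨x, 0⟩
  have hc : extChartAt I.tangent ξ ξ = (extChartAt I x x, 0) := by
    refine (extChartAt_apply (v₀ := ξ) (v := ξ) (_root_.mem_extChartAt_source (I := I) x)).trans ?_
    change (extChartAt I x x, tderiv I 𝓘(ℝ, E) (extChartAt I x) x 0) = _
    rw [map_zero]
  have hs : MDifferentiableAt 𝓘(ℝ, E × E) I.tangent (extChartAt I.tangent ξ).symm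
      (extChartAt I x x, 0) := by
    rw [← hc]
    exact mdifferentiableAt_extChartAt_symm (mem_extChartAt_target ξ)
  have hi : HasFDerivAt (fun v : E => (extChartAt I x x, v)) (ContinuousLinearMap.inr ℝ E E) 0 :=
    hasFDerivAt_prodMk_right _ _
  have he : (fun v : E => (⟨x, v⟩ : TangentBundle I M)) =
      (extChartAt I.tangent ξ).symm ∘ fun v : E => (extChartAt I x x, v) :=
    funext fun v => (extChartAt_symm_fiber x v).symm
  have hd := hi.differentiableAt.mdifferentiableAt
  refine ⟨he ▸ hs.comp 0 hd, ?_⟩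
  have h1 := tderiv_extChartAt_symm_comp (mem_extChartAt_source (I := I.tangent) ξ)
  rw [tderiv_extChartAt_self, hc] at h1
  rw [he, tderiv_comp 0 hs hd, tderiv_eq_fderiv, hi.fderiv]
  exact congrArg (fun A : E × E →L[ℝ] E × E => A ∘L ContinuousLinearMap.inr ℝ E E) h1

end TangentBundle

/-! ### Discretization maps are diffeomorphisms near the zero section -/

namespace IsDiscretizationMap

variable {E : Type*} [NormedAddCommGroup E] [NormedSpace ℝ E]
  {H : Type*} [TopologicalSpace H] {I : ModelWithCorners ℝ E H}
  {Q : Type*} [TopologicalSpace Q] [ChartedSpace H Q] [IsManifold I ∞ Q]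
  {U : Set (TangentBundle I Q)} {R : TangentBundle I Q → Q × Q}

theorem contMDiffAt_zero (hR : IsDiscretizationMap I U R) (x : Q) :
    ContMDiffAt I.tangent (I.prod I) ∞ R ⟨x, 0⟩ :=
  hR.smooth.contMDiffAt (hR.isOpen.mem_nhds (hR.zero_mem x))

variable [FiniteDimensional ℝ E] [I.Boundaryless]

/-- In the horizontal and vertical splitting at `0_x` the derivative is `(u, v) ↦ (u + a v, u + b
v)`, with `b - a = id` by rigidity. Subtracting the components of a kernel vector gives `v = 0`,
then `u = 0`. -/
theorem isInvertible_tderiv_zero (hR : IsDiscretizationMap I U R) (x : Q) :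
    (tderiv I.tangent (I.prod I) R ⟨x, 0⟩).IsInvertible := by
  set T := tderiv I.tangent (I.prod I) R ⟨x, 0⟩ with hT
  have hd : MDifferentiableAt I.tangent (I.prod I) R ⟨x, 0⟩ :=
    (hR.contMDiffAt_zero x).mdifferentiableAt (by simp)
  have hhor (u : E) : T (u, 0) = (u, u) := by
    have hz : MDifferentiableAt I I.tangent (zeroSection E (TangentSpace I : Q → Type _)) x :=
      (contMDiff_zeroSection (n := 1) ℝ (TangentSpace I) x).mdifferentiableAt (by simp)
    have h := tderiv_comp x hd hz
    -- Along the zero section `R` is the diagonal map.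
    have he : R ∘ zeroSection E (TangentSpace I : Q → Type _) = fun y => (id y, id y) :=
      funext hR.map_zero
    rw [he, tderiv_prodMk mdifferentiableAt_id mdifferentiableAt_id, tderiv_id] at h
    have h' := DFunLike.congr_fun h u
    rw [ContinuousLinearMap.comp_apply, TangentBundle.tderiv_zeroSection] at h'
    exact h'.symm
  obtain ⟨hj, hj'⟩ := TangentBundle.mdifferentiableAt_and_tderiv_fiber (I := I) x
  have hver1 (v : E) : (T (0, v)).1 = fiberDeriv I (fun ξ => (R ξ).1) x v := by
    have h := tderiv_comp_of_eq (I := 𝓘(ℝ, E)) (g := Prod.fst ∘ R) (y := ⟨x, 0⟩)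
      (mdifferentiableAt_fst.comp _ hd) hj rfl
    rw [tderiv_comp (⟨x, 0⟩ : TangentBundle I Q) mdifferentiableAt_fst hd, hj', tderiv_fst] at h
    exact (DFunLike.congr_fun h v).symm
  have hver2 (v : E) : (T (0, v)).2 = fiberDeriv I (fun ξ => (R ξ).2) x v := by
    have h := tderiv_comp_of_eq (I := 𝓘(ℝ, E)) (g := Prod.snd ∘ R) (y := ⟨x, 0⟩)
      (mdifferentiableAt_snd.comp _ hd) hj rfl
    rw [tderiv_comp (⟨x, 0⟩ : TangentBundle I Q) mdifferentiableAt_snd hd, hj', tderiv_snd] at h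
    exact (DFunLike.congr_fun h v).symm
  have hker : ∀ X, T X = 0 → X = 0 := by
    rintro ⟨u, v⟩ hX
    have h0 : T (u, v) = T (u, 0) + T (0, v) := by rw [← map_add]; simp
    have hv : (T (0, v)).2 - (T (0, v)).1 = v := by
      rw [hver1, hver2]
      exact DFunLike.congr_fun (hR.rigid x) v
    rw [h0, hhor] at hX
    have h1 : u + (T (0, v)).1 = 0 := congrArg Prod.fst hX
    have h2 : u + (T (0, v)).2 = 0 := congrArg Prod.snd hX
    have hv0 : v = 0 := by
      rw [← hv, ← add_sub_add_left_eq_sub _ _ u, h1, h2, sub_zero]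
    subst hv0
    have : T (0, (0 : E)) = 0 := _root_.map_zero T
    rw [this] at h1
    exact Prod.ext (by simpa using h1) rfl
  have hTi : Function.Injective T := (injective_iff_map_eq_zero T).2 hker
  exact ⟨(LinearEquiv.ofInjectiveEndo (T : _ →ₗ[ℝ] _) hTi).toContinuousLinearEquiv,
    ContinuousLinearMap.ext fun _ => rfl⟩

/-- A discretization map is a diffeomorphism from a neighbourhood of the zero section onto an open
set. -/
theorem exists_isDiffeoOn [T2Space Q] [SecondCountableTopology Q]
    (hR : IsDiscretizationMap I U R) :
    ∃ V ⊆ U, (∀ x : Q, (⟨x, 0⟩ : TangentBundle I Q) ∈ V) ∧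
      IsDiffeoOn I.tangent (I.prod I) R V (R '' V) := by
  have := FiniteDimensional.complete ℝ E
  have := TangentBundle.metrizableSpace (I := I) (M := Q)
  obtain ⟨V, hV, hzV, hinj⟩ := exists_isOpen_injOn_of_section (f := R) (p := Prod.fst)
    (z := zeroSection E (TangentSpace I : Q → Type _))
    (contMDiff_zeroSection (n := 1) (IB := I) ℝ (TangentSpace I)).continuous
    (fun x => congrArg Prod.fst (hR.map_zero x))
    (fun x => continuous_fst.continuousAt.comp (hR.contMDiffAt_zero x).continuousAt)
    (fun x => (hR.contMDiffAt_zero x).exists_mem_nhds_injOn (hR.isInvertible_tderiv_zero x))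
  -- Injectivity does not give invertible derivatives, so the neighbourhood is shrunk to where they
  -- are invertible.
  let W := interior {ξ | (tderiv I.tangent (I.prod I) R ξ).IsInvertible}
  refine ⟨U ∩ V ∩ W, fun _ h => h.1.1, fun x => ⟨⟨hR.zero_mem x, hzV x⟩, ?_⟩, ?_⟩
  · exact mem_interior_iff_mem_nhds.2 ((hR.contMDiffAt_zero x).eventually_isInvertible_tderiv
      (hR.isInvertible_tderiv_zero x))
  · exact isDiffeoOn_image_of_injOn ((hR.isOpen.inter hV).inter isOpen_interior)
      (hR.smooth.mono fun _ h => h.1.1) (hinj.mono fun _ h => h.1.2)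
      (fun ξ h => (interior_subset h.2 : _)) (fun q => ⟨q.1, 0⟩)

end IsDiscretizationMap

end

/-- The global case, `R` a diffeomorphism from `TQ` onto `Q × Q`, is the last clause with `U` and
`V` the whole of `TQ`: both preimages are then everything. -/
theorem mainTheorem1 {E : Type*} [NormedAddCommGroup E] [NormedSpace ℝ E] [FiniteDimensional ℝ E]
    {Q : Type*} [TopologicalSpace Q] [T2Space Q] [SecondCountableTopology Q]
    [ChartedSpace E Q] [IsManifold 𝓘(ℝ, E) ∞ Q]
    (U : Set (TangentBundle 𝓘(ℝ, E) Q)) (R : TangentBundle 𝓘(ℝ, E) Q → Q × Q)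
    (hR : IsDiscretizationMap 𝓘(ℝ, E) U R) :
    -- both manifolds are symplectic
    DiffForm.IsSymplectic 𝓘(ℝ, E).cotangent.tangent
      (DiffForm.dT 𝓘(ℝ, E).cotangent (canonicalForm 𝓘(ℝ, E) Q)) ∧
    DiffForm.IsSymplectic (𝓘(ℝ, E).cotangent.prod 𝓘(ℝ, E).cotangent) (omega12 𝓘(ℝ, E) Q) ∧
    -- `R` is a diffeomorphism from a neighbourhood of the zero section onto an open set
    (∃ V ⊆ U, (∀ x : Q, (⟨x, 0⟩ : TangentBundle 𝓘(ℝ, E) Q) ∈ V) ∧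
      IsDiffeoOn 𝓘(ℝ, E).tangent (𝓘(ℝ, E).prod 𝓘(ℝ, E)) R V (R '' V)) ∧
    -- wherever `R` is a diffeomorphism, its cotangent lift is a symplectomorphism
    (∀ V ⊆ U, IsDiffeoOn 𝓘(ℝ, E).tangent (𝓘(ℝ, E).prod 𝓘(ℝ, E)) R V (R '' V) →
      IsSymplectoOn 𝓘(ℝ, E).cotangent.tangent (𝓘(ℝ, E).cotangent.prod 𝓘(ℝ, E).cotangent)
        (DiffForm.dT 𝓘(ℝ, E).cotangent (canonicalForm 𝓘(ℝ, E) Q)) (omega12 𝓘(ℝ, E) Q)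
        (cotangentLift 𝓘(ℝ, E) R)
        (tangentMap 𝓘(ℝ, E).cotangent 𝓘(ℝ, E) (cotangentProj 𝓘(ℝ, E) (M := Q)) ⁻¹' V)
        (Prod.map (cotangentProj 𝓘(ℝ, E)) (cotangentProj 𝓘(ℝ, E)) ⁻¹' (R '' V))) := by
  have := FiniteDimensional.complete ℝ E
  exact ⟨DiffForm.isSymplectic_dT_canonicalForm, DiffForm.isSymplectic_omega12,
    hR.exists_isDiffeoOn, fun _ _ hV => isSymplectoOn_cotangentLift hV⟩
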